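/- Let $N\ge 2$, $0<s<1$, $1<p<\infty$ with $sp>1$, and $L\ge 0$. There is a constant $C=C(N,s,p,L)>0$ with the following property. Let $\eta:\mathbb R^{N-1}\to(0,\infty)$ be Lipschitz continuous with Lipschitz constant at most $L$, let $\Omega=\{(x',x_N)\in\mathbb R^{N-1}\times\mathbb R:0<x_N<\eta(x')\}$, and let $g\in L^p_{\mathrm{loc}}(\mathbb R^{N-1})$ satisfy $$[g]_{1}^p:=\int_{\mathbb R^{N-1}}\int_{B(x',\eta(x')/2)}\frac{|g(x')-g(y')|^p}{\|x'-y'\|^{N-2+sp}}\,dy'\,dx'<\infty,$$ $$[g]_{2}^p:=\int_{\mathbb R^{N-1}}\int_{\mathbb R^{N-1}\setminus B(x',\eta(x')/2)}\eta(x')\eta(y')\frac{|g(x')-g(y')|^p}{\|x'-y'\|^{N+sp}}\,dy'\,dx'<\infty,$$ $$\int_{\mathbb R^{N-1}}\frac{|g(x')|^p}{\eta(x')^{sp-1}}\,dx'<\infty .$$ Then there is $u\in\dot W^{s,p}(\Omega)$, that is, $u\in L^p_{\mathrm{loc}}(\Omega)$ with $$|u|_{\dot W^{s,p}(\Omega)}:=\Big(\int_\Omega\int_\Omega\frac{|u(x)-u(y)|^p}{\|x-y\|^{N+sp}}\,dy\,dx\Big)^{1/p}<\infty,$$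 such that, for a.e. $x'\in\mathbb R^{N-1}$, $\operatorname{Tr}(u)(x',0)=g(x')$ and $\operatorname{Tr}(u)(x',\eta(x'))=0$, and $$C\,|u|_{\dot W^{s,p}(\Omega)}\le [g]_1+[g]_2+\|g/\eta^{s-1/p}\|_{L^p(\mathbb R^{N-1})}.$$ Here, for $\gamma\in\{0,\eta\}$, $\operatorname{Tr}(u)(x',\gamma(x'))=h(x')$ means that the mean value of $|u-h(x')|$ over $\Omega\cap B((x',\gamma(x')),r)$ tends to $0$ as $r\to0^+$. -/

import Mathlib

open MeasureTheory Filter Topology Set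
open scoped ENNReal NNReal

noncomputable section

/-- The Euclidean space `ℝ^{N-1}` of the horizontal variable `x'`. -/
abbrev Horiz (N : ℕ) : Type := EuclideanSpace ℝ (Fin (N - 1))

/-- `ℝ^N`, written as `ℝ^{N-1} × ℝ ∋ (x', x_N)`. Its `volume` is the product Lebesgue measure. The
product type carries the sup distance, so the Euclidean distance is `euclDist` below. -/
abbrev FullSpace (N : ℕ) : Type := Horiz N × ℝ

/-- The Euclidean distance `‖x - y‖` of `ℝ^N`. -/
def euclDist {N : ℕ} (x y : FullSpace N) : ℝ :=
  Real.sqrt (‖x.1 - y.1‖ ^ 2 + (x.2 - y.2) ^ 2)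

/-- The open Euclidean ball of `ℝ^N`. -/
def euclBall {N : ℕ} (x : FullSpace N) (r : ℝ) : Set (FullSpace N) :=
  {y | euclDist y x < r}

/-- The domain `{(x', x_N) : 0 < x_N < η(x')}`. -/
def stripDomain {N : ℕ} (η : Horiz N → ℝ) : Set (FullSpace N) :=
  {x | 0 < x.2 ∧ x.2 < η x.1}

/-- `f ∈ L^p_loc(U)`: `f` is in `L^p(K)` for every compact `K ⊆ U`. -/
def MemLpLoc {X : Type*} [TopologicalSpace X] [MeasureSpace X]
    (f : X → ℝ) (p : ℝ) (U : Set X) : Prop :=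
  ∀ K : Set X, IsCompact K → K ⊆ U → MemLp f (ENNReal.ofReal p) (volume.restrict K)

/-- The seminorm `(∫_U ∫_U |u(x) - u(y)|^p / ‖x - y‖^{N+sp} dy dx)^{1/p}`. -/
def gagliardo {N : ℕ} (s p : ℝ) (U : Set (FullSpace N)) (u : FullSpace N → ℝ) : ℝ≥0∞ :=
  (∫⁻ x in U, ∫⁻ y in U,
    ENNReal.ofReal (|u x - u y| ^ p / euclDist x y ^ ((N : ℝ) + s * p))) ^ (1 / p)

/-- `u ∈ Ẇ^{s,p}(U)`. -/
def MemHomSobolev {N : ℕ} (s p : ℝ) (U : Set (FullSpace N)) (u : FullSpace N → ℝ) : Prop :=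
  MemLpLoc u p U ∧ gagliardo s p U u < ∞

/-- The short-range integral
`∫ ∫_{B(x', η(x')/2)} |g(x') - g(y')|^p / ‖x' - y'‖^{N-2+sp} dy' dx'`. -/
def nearEnergy {N : ℕ} (s p : ℝ) (η g : Horiz N → ℝ) : ℝ≥0∞ :=
  ∫⁻ x, ∫⁻ y in Metric.ball x (η x / 2),
    ENNReal.ofReal (|g x - g y| ^ p / ‖x - y‖ ^ ((N : ℝ) - 2 + s * p))

/-- The long-range integral
`∫ ∫_{ℝ^{N-1} \ B(x', η(x')/2)} η(x') η(y') |g(x') - g(y')|^p / ‖x' - y'‖^{N+sp} dy' dx'`. -/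
def farEnergy {N : ℕ} (s p : ℝ) (η g : Horiz N → ℝ) : ℝ≥0∞ :=
  ∫⁻ x, ∫⁻ y in (Metric.ball x (η x / 2))ᶜ,
    ENNReal.ofReal (η x * η y * (|g x - g y| ^ p / ‖x - y‖ ^ ((N : ℝ) + s * p)))

/-- `g` is the trace of `u : U → ℝ` on the part `{(x', γ(x'))}` of the boundary of `U`, written in
the graph coordinate `x'`: for a.e. `x'`, the mean of `|u - g(x')|` over `U ∩ B((x', γ(x')), r)`
tends to `0` as `r → 0⁺`. Such a `g` is unique up to null sets, and it is the restriction of `u` to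
the graph if `u` is continuous up to the boundary. -/
def HasTraceOnGraph {N : ℕ} (U : Set (FullSpace N)) (u : FullSpace N → ℝ)
    (γ g : Horiz N → ℝ) : Prop :=
  ∀ᵐ x : Horiz N,
    Tendsto (fun r : ℝ => ⨍⁻ y in U ∩ euclBall (x, γ x) r, ENNReal.ofReal |u y - g x| ∂volume)
      (𝓝[>] 0) (𝓝 0)

end

/-! The extension is `stripExtension`: at height t above x', g is averaged against a tent of radius
t/4 around x', and the result is multiplied by a cutoff that falls linearly in t/η(x') from 1 at the
bottom to 0 at mid-height.

Let q = N + sp and let δ be the distance of two points x and y. The core is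
`enorm_stripExtension_sub_rpow_le`, a pointwise bound for |u(x) - u(y)|^p δ^{-q}. When δ is small
compared to the height, two tent averages differ by at most (δ/height) times the local oscillation
of g. Otherwise they are compared through g(x') and g(y'), which leaves two local oscillations and
|g(x') - g(y')|^p. The cutoff varies at scale η because η is Lipschitz, and contributes |g(y')|^p.

Each term is then integrated. The kernel min(1, δ/T)^p δ^{-q} has integral at most a multiple of
T^{-sp}, because 0 < sp < p. With T the height, Fubini turns the oscillation into `nearEnergy`
(`lintegral_Ioo_scaledOsc_le`); with T = η(y') the weighted norm of g appears
(`setLIntegral_weighted_boundary`). In the term |g(x') - g(y')|^p both heights are at most 9δ, so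
with ρ = ‖x' - y'‖ integrating them out yields ρ^{2-q} for the nearby pairs and η(x')η(y')ρ^{-q} for
the others (`setLIntegral_farKernel_le`).

The upper trace is zero because u vanishes near the upper boundary. The lower trace is g at every
Lebesgue point of g. -/

/-! ### Integrals of power kernels -/

theorem lintegral_Ioi_rpow_neg {β b : ℝ} (hβ : 1 < β) (hb : 0 < b) :
    ∫⁻ t in Ioi b, ENNReal.ofReal (t ^ (-β)) = ENNReal.ofReal (b ^ (1 - β) / (β - 1)) := by
  rw [← ofReal_integral_eq_lintegral_ofReal (integrableOn_Ioi_rpow_of_lt (by linarith) hb),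
    integral_Ioi_rpow_of_lt (by linarith) hb]
  · congr 1
    rw [show -β + 1 = 1 - β by ring, neg_div, ← div_neg]
    congr 1; ring
  · filter_upwards [ae_restrict_mem measurableSet_Ioi] with t ht
    exact Real.rpow_nonneg (hb.le.trans (le_of_lt ht)) _

/-- The two entries of the maximum cross at t = Mρ: the constant part below contributes M, the tail
above contributes M / (a - 1). -/
theorem lintegral_Ioi_max_rpow_neg_le {a M : ℝ} (ha : 1 < a) (hM : 0 < M) :
    ∃ K : ℝ≥0, ∀ ρ : ℝ, 0 < ρ →
      ∫⁻ t in Ioi (0 : ℝ), ENNReal.ofReal ((max ρ (t / M)) ^ (-a)) ≤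
        K * ENNReal.ofReal (ρ ^ (1 - a)) := by
  refine ⟨(M + M / (a - 1)).toNNReal, fun ρ hρ => ?_⟩
  have ha' : 0 < a - 1 := by linarith
  have hMρ : 0 < M * ρ := by positivity
  rw [← Ioc_union_Ioi_eq_Ioi hMρ.le]
  refine (lintegral_union_le _ _ _).trans ?_
  have h1 : ∫⁻ t in Ioc 0 (M * ρ), ENNReal.ofReal ((max ρ (t / M)) ^ (-a)) ≤
      ENNReal.ofReal (M * ρ ^ (1 - a)) := by
    calc _ ≤ ∫⁻ t in Ioc 0 (M * ρ), ENNReal.ofReal (ρ ^ (-a)) := by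
          refine lintegral_mono fun t => ENNReal.ofReal_le_ofReal ?_
          exact Real.rpow_le_rpow_of_nonpos hρ (le_max_left _ _) (by linarith)
      _ = _ := by
          rw [setLIntegral_const, Real.volume_Ioc, ← ENNReal.ofReal_mul (by positivity)]
          congr 1
          rw [sub_zero, sub_eq_add_neg, Real.rpow_add hρ, Real.rpow_one]; ring
  have h2 : ∫⁻ t in Ioi (M * ρ), ENNReal.ofReal ((max ρ (t / M)) ^ (-a)) ≤
      ENNReal.ofReal (M / (a - 1) * ρ ^ (1 - a)) := by
    calc _ ≤ ∫⁻ t in Ioi (M * ρ), ENNReal.ofReal (M ^ a) * ENNReal.ofReal (t ^ (-a)) := by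
          refine setLIntegral_mono' measurableSet_Ioi fun t ht => ?_
          have ht0 : 0 < t := hMρ.trans ht
          rw [← ENNReal.ofReal_mul (by positivity)]
          refine ENNReal.ofReal_le_ofReal ?_
          calc _ ≤ (t / M) ^ (-a) :=
                Real.rpow_le_rpow_of_nonpos (by positivity) (le_max_right _ _) (by linarith)
            _ = _ := by
                rw [Real.div_rpow ht0.le hM.le, Real.rpow_neg hM.le, div_inv_eq_mul, mul_comm]
      _ = _ := by
          rw [lintegral_const_mul' _ _ ENNReal.ofReal_ne_top, lintegral_Ioi_rpow_neg ha hMρ,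
            ← ENNReal.ofReal_mul (by positivity)]
          congr 1
          rw [Real.mul_rpow hM.le hρ.le, sub_eq_add_neg 1 a, Real.rpow_add hM, Real.rpow_one,
            Real.rpow_neg hM.le]
          have : M ^ a ≠ 0 := (Real.rpow_pos_of_pos hM _).ne'
          field_simp
  refine (add_le_add h1 h2).trans ?_
  rw [← ENNReal.ofReal_add (by positivity) (by positivity),
    ENNReal.ofNNReal_toNNReal, ← ENNReal.ofReal_mul (by positivity)]
  exact ENNReal.ofReal_le_ofReal (by ring_nf; rfl)

theorem lintegral_comp_norm_div {F : Type*} [NormedAddCommGroup F] [NormedSpace ℝ F]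
    [FiniteDimensional ℝ F] [MeasurableSpace F] [BorelSpace F] (μ : Measure F)
    [μ.IsAddHaarMeasure] {φ : ℝ → ℝ≥0∞} (hφ : Measurable φ) {T : ℝ} (hT : 0 < T) :
    ∫⁻ x, φ (‖x‖ / T) ∂μ = ENNReal.ofReal (T ^ Module.finrank ℝ F) * ∫⁻ x, φ ‖x‖ ∂μ := by
  have h := Measure.map_addHaar_smul μ (inv_ne_zero hT.ne')
  have h2 : ∫⁻ x, φ ‖x‖ ∂(Measure.map (T⁻¹ • ·) μ) = ∫⁻ x, φ (‖x‖ / T) ∂μ := by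
    rw [lintegral_map (by fun_prop) (by fun_prop)]
    simp [norm_smul, abs_of_pos hT, div_eq_inv_mul]
  rw [← h2, h, lintegral_smul_measure, abs_of_pos (by positivity)]
  simp

/-- In polar coordinates, q > dim F gives convergence at infinity, and q < dim F + p gives it at the
origin. -/
theorem integrable_truncated_kernel {F : Type*} [NormedAddCommGroup F] [NormedSpace ℝ F]
    [FiniteDimensional ℝ F] [Nontrivial F] [MeasurableSpace F] [BorelSpace F] (μ : Measure F)
    [μ.IsAddHaarMeasure] {p q : ℝ} (hq : (Module.finrank ℝ F : ℝ) < q)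
    (hqp : q < Module.finrank ℝ F + p) :
    Integrable (fun x : F => (min 1 ‖x‖) ^ p * ‖x‖ ^ (-q)) μ := by
  refine (integrable_fun_norm_addHaar μ (f := fun r => (min 1 r) ^ p * r ^ (-q))).2 ?_
  have hd : 1 ≤ Module.finrank ℝ F := Module.finrank_pos
  set d := Module.finrank ℝ F
  have key : ∀ r : ℝ, 0 < r → ∀ e : ℝ, r ^ (d - 1) * r ^ e = r ^ ((d : ℝ) - 1 + e) := by
    intro r hr e
    rw [Real.rpow_add hr, ← Real.rpow_natCast, Nat.cast_sub hd, Nat.cast_one]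
  rw [← Ioc_union_Ioi_eq_Ioi zero_le_one]
  refine IntegrableOn.union ?_ ?_
  · have h : IntegrableOn (fun r : ℝ => r ^ ((d : ℝ) - 1 + (p - q))) (Ioc 0 1) := by
      rw [← intervalIntegrable_iff_integrableOn_Ioc_of_le zero_le_one]
      exact intervalIntegral.intervalIntegrable_rpow' (by linarith)
    refine h.congr_fun (fun r hr => ?_) measurableSet_Ioc
    simp only [smul_eq_mul]
    rw [min_eq_right hr.2, ← Real.rpow_add hr.1, key r hr.1]; rfl
  · have h : IntegrableOn (fun r : ℝ => r ^ ((d : ℝ) - 1 + (-q))) (Ioi 1) :=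
      integrableOn_Ioi_rpow_of_lt (by linarith) one_pos
    refine h.congr_fun (fun r hr => ?_) measurableSet_Ioi
    simp only [smul_eq_mul]
    rw [min_eq_left (le_of_lt hr), Real.one_rpow, one_mul, key r (one_pos.trans hr)]

/-- The kernel `min(1, δ/T)^p δ^{-q}`. -/
noncomputable def truncKernel (p q T δ : ℝ) : ℝ≥0∞ :=
  ENNReal.ofReal ((min 1 (δ / T)) ^ p * δ ^ (-q))

theorem measurable_truncKernel (p q : ℝ) :
    Measurable (fun x : ℝ × ℝ => truncKernel p q x.1 x.2) := by
  unfold truncKernel; fun_prop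

theorem Measurable.truncKernel {α : Type*} [MeasurableSpace α] {p q : ℝ} {f g : α → ℝ}
    (hf : Measurable f) (hg : Measurable g) :
    Measurable fun x => truncKernel p q (f x) (g x) :=
  (measurable_truncKernel p q).comp (hf.prodMk hg)

/-- Translation moves y to 0 and the scaling x ↦ x / T reduces to T = 1, so the power of T is
dictated by homogeneity. -/
theorem lintegral_truncKernel_le {F : Type*} [NormedAddCommGroup F] [NormedSpace ℝ F]
    [FiniteDimensional ℝ F] [Nontrivial F] [MeasurableSpace F] [BorelSpace F] (μ : Measure F)
    [μ.IsAddHaarMeasure] {p q : ℝ} (hq : (Module.finrank ℝ F : ℝ) < q)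
    (hqp : q < Module.finrank ℝ F + p) :
    ∃ K : ℝ≥0, ∀ T : ℝ, 0 < T → ∀ y : F,
      ∫⁻ x, truncKernel p q T (dist x y) ∂μ ≤
        K * ENNReal.ofReal (T ^ ((Module.finrank ℝ F : ℝ) - q)) := by
  have hfin := (integrable_truncated_kernel μ hq hqp).lintegral_lt_top
  refine ⟨(∫⁻ x : F, ENNReal.ofReal ((min 1 ‖x‖) ^ p * ‖x‖ ^ (-q)) ∂μ).toNNReal,
    fun T hT y => ?_⟩
  rw [ENNReal.coe_toNNReal hfin.ne]
  have h1 : ∫⁻ x, truncKernel p q T (dist x y) ∂μ = ∫⁻ x, truncKernel p q T ‖x‖ ∂μ := by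
    simp_rw [dist_eq_norm]
    exact lintegral_sub_right_eq_self (fun x => truncKernel p q T ‖x‖) y
  have h2 : ∀ δ : ℝ, 0 ≤ δ → truncKernel p q T δ =
      ENNReal.ofReal (T ^ (-q)) * truncKernel p q 1 (δ / T) := by
    intro δ hδ
    unfold truncKernel
    rw [← ENNReal.ofReal_mul (by positivity), div_one, Real.div_rpow hδ hT.le]
    have : T ^ (-q) ≠ 0 := (Real.rpow_pos_of_pos hT _).ne'
    congr 1; field_simp
  rw [h1]
  simp_rw [fun x : F => h2 ‖x‖ (norm_nonneg x)]
  rw [lintegral_const_mul' _ _ ENNReal.ofReal_ne_top,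
    lintegral_comp_norm_div μ (φ := truncKernel p q 1)
      (measurable_const.truncKernel measurable_id) hT,
    ← mul_assoc, ← ENNReal.ofReal_mul (by positivity), mul_comm]
  refine le_of_eq ?_
  congr 1
  · simp [truncKernel]
  · congr 1
    rw [sub_eq_add_neg, Real.rpow_add hT, Real.rpow_natCast, mul_comm]

/-! ### Tent functions -/

section Tent

variable {E : Type*} [NormedAddCommGroup E]

/-- The tent function of height and radius `t / 4` centred at `x'`, where `y = (x', t)`. -/
noncomputable def tent (y : E × ℝ) (z : E) : ℝ := max 0 (y.2 / 4 - ‖z - y.1‖)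

theorem tent_nonneg (y : E × ℝ) (z : E) : 0 ≤ tent y z := le_max_left _ _

theorem continuous_uncurry_tent : Continuous (fun x : (E × ℝ) × E => tent x.1 x.2) := by
  unfold tent; fun_prop

theorem continuous_tent (y : E × ℝ) : Continuous (tent y) := by
  unfold tent; fun_prop

theorem tent_eq_zero {y : E × ℝ} {z : E} (h : z ∉ Metric.ball y.1 (1 / 4 * y.2)) :
    tent y z = 0 := by
  rw [Metric.mem_ball, dist_eq_norm, not_lt] at h
  exact max_eq_left (by linarith)

theorem tent_le {y : E × ℝ} (hy : 0 < y.2) (z : E) : tent y z ≤ y.2 / 4 :=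
  max_le (by positivity) (by linarith [norm_nonneg (z - y.1)])

theorem abs_tent_sub_tent_le (x y : E × ℝ) (z : E) : |tent x z - tent y z| ≤ 2 * dist x y := by
  have h1 : dist x.1 y.1 ≤ dist x y := le_max_left _ _
  have h2 : dist x.2 y.2 ≤ dist x y := le_max_right _ _
  rw [Real.dist_eq] at h2
  rw [dist_eq_norm] at h1
  have h3 : |‖z - x.1‖ - ‖z - y.1‖| ≤ ‖x.1 - y.1‖ := by
    refine (abs_norm_sub_norm_le _ _).trans_eq ?_
    rw [sub_sub_sub_cancel_left, norm_sub_rev]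
  unfold tent
  refine (abs_max_sub_max_le_max _ _ _ _).trans ?_
  rw [sub_self, abs_zero, max_eq_right (abs_nonneg _)]
  rw [abs_le] at *
  constructor <;> linarith [dist_nonneg (x := x) (y := y)]

/-- The support of `tent x` reaches at most (9/8)(y.2/4) + y.2/8 = (13/32) y.2 from `y.1`, which is
less than y.2/2. -/
theorem tent_sub_tent_eq_zero {x y : E × ℝ} (hxy : dist x y < y.2 / 8) {z : E}
    (h : z ∉ Metric.ball y.1 (1 / 2 * y.2)) : tent x z - tent y z = 0 := by
  have h1 : dist x.1 y.1 < y.2 / 8 := (le_max_left _ _).trans_lt hxy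
  have h2 : dist x.2 y.2 < y.2 / 8 := (le_max_right _ _).trans_lt hxy
  rw [Real.dist_eq, abs_lt] at h2
  have hy : 0 < y.2 := by linarith
  rw [Metric.mem_ball, not_lt] at h
  have h3 := dist_triangle z x.1 y.1
  rw [tent_eq_zero, tent_eq_zero, sub_zero]
  · rw [Metric.mem_ball, not_lt]; linarith
  · rw [Metric.mem_ball, not_lt]; linarith

end Tent

/-! ### Tent averages and local oscillation -/

section Averaging

variable {E : Type*} [NormedAddCommGroup E] [NormedSpace ℝ E] [FiniteDimensional ℝ E]
  [MeasureSpace E] [BorelSpace E] [(volume : Measure E).IsAddHaarMeasure]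

/-- The integral of `f` over the ball `B(x', r t)`, divided by `t^{dim E}`, where `y = (x', t)`. -/
noncomputable def scaledLIntegral (f : E → ℝ≥0∞) (y : E × ℝ) (r : ℝ) : ℝ≥0∞ :=
  ENNReal.ofReal ((y.2 ^ Module.finrank ℝ E)⁻¹) * ∫⁻ z in Metric.ball y.1 (r * y.2), f z

/-- The average of `g` with respect to the tent function `tent y`. -/
noncomputable def tentAverage (g : E → ℝ) (y : E × ℝ) : ℝ :=
  (∫ z, tent y z)⁻¹ * ∫ z, tent y z * g z

omit [MeasureSpace E] [BorelSpace E] [(volume : Measure E).IsAddHaarMeasure] in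
theorem hasCompactSupport_tent (y : E × ℝ) : HasCompactSupport (tent y) := by
  refine HasCompactSupport.intro (isCompact_closedBall y.1 (1 / 4 * y.2)) fun z hz => ?_
  exact tent_eq_zero fun h => hz (Metric.ball_subset_closedBall h)

omit [(volume : Measure E).IsAddHaarMeasure] in
theorem integrable_tent_mul {g : E → ℝ} (hg : LocallyIntegrable g) (y : E × ℝ) :
    Integrable (fun z => tent y z * g z) :=
  hg.integrable_smul_left_of_hasCompactSupport (continuous_tent y) (hasCompactSupport_tent y)

theorem integrable_tent (y : E × ℝ) : Integrable (tent y) :=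
  (continuous_tent y).integrable_of_hasCompactSupport (hasCompactSupport_tent y)

/-- On the ball of radius y.2/8 the tent is at least y.2/8. -/
theorem exists_integral_tent_ge : ∃ c : ℝ, 0 < c ∧ ∀ y : E × ℝ, 0 < y.2 →
    c * y.2 ^ (Module.finrank ℝ E + 1) ≤ ∫ z, tent y z := by
  have hκ : 0 < volume.real (Metric.ball (0 : E) 1) :=
    ENNReal.toReal_pos (Metric.measure_ball_pos volume 0 one_pos).ne' measure_ball_lt_top.ne
  refine ⟨(1 / 8) ^ (Module.finrank ℝ E + 1) * volume.real (Metric.ball (0 : E) 1),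
    by positivity, fun y hy => ?_⟩
  calc _ = ∫ z in Metric.ball y.1 (y.2 / 8), y.2 / 8 := by
        rw [setIntegral_const, Measure.real, Measure.real,
          Measure.addHaar_ball_of_pos _ y.1 (by positivity : 0 < y.2 / 8),
          ENNReal.toReal_mul, ENNReal.toReal_ofReal (by positivity), smul_eq_mul]
        ring
    _ ≤ ∫ z in Metric.ball y.1 (y.2 / 8), tent y z := by
        refine setIntegral_mono_on ?_ (integrable_tent y).integrableOn Metric.isOpen_ball.measurableSet
          fun z hz => ?_
        · exact integrableOn_const measure_ball_lt_top.ne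
        · rw [Metric.mem_ball, dist_eq_norm] at hz
          exact le_max_of_le_right (by linarith)
    _ ≤ _ := setIntegral_le_integral (integrable_tent y) (ae_of_all _ (tent_nonneg y))

theorem integral_tent_pos {y : E × ℝ} (hy : 0 < y.2) : 0 < ∫ z, tent y z := by
  obtain ⟨c, hc, h⟩ := exists_integral_tent_ge (E := E)
  exact (by positivity : 0 < c * y.2 ^ (Module.finrank ℝ E + 1)).trans_le (h y hy)

theorem tentAverage_sub_const {g : E → ℝ} (hg : LocallyIntegrable g) {y : E × ℝ} (hy : 0 < y.2)
    (a : ℝ) : tentAverage g y - a = (∫ z, tent y z)⁻¹ * ∫ z, tent y z * (g z - a) := by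
  have h := (integral_tent_pos hy).ne'
  simp_rw [mul_sub]
  rw [integral_sub (integrable_tent_mul hg y) ((integrable_tent y).mul_const a),
    integral_mul_const, tentAverage]
  field_simp

/-- Subtracting the average at y from g makes its integral against `tent y` vanish, so that integral
can be inserted freely. Only the normalisation at x remains, and the two normalising integrals never
have to be compared. -/
theorem tentAverage_sub_tentAverage {g : E → ℝ} (hg : LocallyIntegrable g) {x y : E × ℝ}
    (hx : 0 < x.2) (hy : 0 < y.2) : tentAverage g x - tentAverage g y =
      (∫ z, tent x z)⁻¹ * ∫ z, (tent x z - tent y z) * (g z - tentAverage g y) := by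
  have h0 : ∫ z, tent y z * (g z - tentAverage g y) = 0 := by
    have h := tentAverage_sub_const hg hy (tentAverage g y)
    rw [sub_self] at h
    exact (mul_eq_zero.1 h.symm).resolve_left (inv_ne_zero (integral_tent_pos hy).ne')
  have hi : ∀ w : E × ℝ, Integrable (fun z => tent w z * (g z - tentAverage g y)) := fun w => by
    simp_rw [mul_sub]
    exact (integrable_tent_mul hg w).sub ((integrable_tent w).mul_const _)
  simp_rw [sub_mul]
  rw [integral_sub (hi x) (hi y), h0, sub_zero, tentAverage_sub_const hg hx]

theorem enorm_tentAverage_sub_le : ∃ K : ℝ≥0, ∀ g : E → ℝ, LocallyIntegrable g →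
    ∀ y : E × ℝ, 0 < y.2 → ∀ a : ℝ,
      ‖tentAverage g y - a‖ₑ ≤ K * scaledLIntegral (fun z => ‖g z - a‖ₑ) y (1 / 4) := by
  obtain ⟨c, hc, hcy⟩ := exists_integral_tent_ge (E := E)
  refine ⟨(c⁻¹ / 4).toNNReal, fun g hg y hy a => ?_⟩
  have hI := integral_tent_pos hy
  rw [tentAverage_sub_const hg hy, enorm_mul, scaledLIntegral, ENNReal.ofNNReal_toNNReal]
  calc _ ≤ ENNReal.ofReal ((c * y.2 ^ (Module.finrank ℝ E + 1))⁻¹) *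
        (ENNReal.ofReal (y.2 / 4) * ∫⁻ z in Metric.ball y.1 (1 / 4 * y.2), ‖g z - a‖ₑ) := by
        refine mul_le_mul' ?_ ?_
        · rw [Real.enorm_of_nonneg (by positivity)]
          exact ENNReal.ofReal_le_ofReal (inv_anti₀ (by positivity) (hcy y hy))
        · refine (enorm_integral_le_lintegral_enorm _).trans ?_
          rw [← lintegral_const_mul' _ _ ENNReal.ofReal_ne_top,
            ← lintegral_indicator Metric.isOpen_ball.measurableSet]
          refine lintegral_mono fun z => ?_
          by_cases hz : z ∈ Metric.ball y.1 (1 / 4 * y.2)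
          · rw [indicator_of_mem hz, enorm_mul, Real.enorm_of_nonneg (tent_nonneg y z)]
            gcongr
            exact tent_le hy z
          · simp [tent_eq_zero hz]
    _ = _ := by
        rw [← mul_assoc, ← mul_assoc, ← ENNReal.ofReal_mul (by positivity),
          ← ENNReal.ofReal_mul (by positivity)]
        congr 2
        field_simp
        ring

omit [FiniteDimensional ℝ E] [BorelSpace E] [(volume : Measure E).IsAddHaarMeasure] in
theorem scaledLIntegral_mono (f : E → ℝ≥0∞) {y : E × ℝ} (hy : 0 < y.2) {r r' : ℝ} (h : r ≤ r') :
    scaledLIntegral f y r ≤ scaledLIntegral f y r' := by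
  unfold scaledLIntegral
  gcongr

theorem volume_ball_mul_inv {y : E × ℝ} (hy : 0 < y.2) {r : ℝ} (hr : 0 < r) :
    ENNReal.ofReal ((y.2 ^ Module.finrank ℝ E)⁻¹) * volume (Metric.ball y.1 (r * y.2)) =
      ENNReal.ofReal (r ^ Module.finrank ℝ E) * volume (Metric.ball (0 : E) 1) := by
  rw [Measure.addHaar_ball_of_pos _ _ (by positivity), ← mul_assoc,
    ← ENNReal.ofReal_mul (by positivity)]
  congr 2
  rw [mul_pow]
  field_simp

theorem enorm_tentAverage_sub_tentAverage_le : ∃ K : ℝ≥0, ∀ g : E → ℝ, LocallyIntegrable g →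
    ∀ x y : E × ℝ, 0 < y.2 → dist x y < y.2 / 8 →
      ‖tentAverage g x - tentAverage g y‖ₑ ≤ K * ENNReal.ofReal (dist x y / y.2) *
        scaledLIntegral (fun z => ‖g z - g y.1‖ₑ) y (1 / 2) := by
  obtain ⟨c, hc, hcy⟩ := exists_integral_tent_ge (E := E)
  obtain ⟨K, hK⟩ := enorm_tentAverage_sub_le (E := E)
  set d := Module.finrank ℝ E with hd
  set κ : ℝ≥0 := (volume (Metric.ball (0 : E) 1)).toNNReal with hκ
  have hκ' : volume (Metric.ball (0 : E) 1) = κ :=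
    (ENNReal.coe_toNNReal measure_ball_lt_top.ne).symm
  -- The first factor combines the normalisation at height x.2 ≥ y.2/2 with the Lipschitz constant 2
  -- of the tent. The second is the cost of replacing the average at y by `g y.1` inside the
  -- oscillation.
  refine ⟨(c⁻¹ * 2 ^ (d + 2)).toNNReal * (1 + ((1 / 2) ^ d : ℝ).toNNReal * κ * K),
    fun g hg x y hy hxy => ?_⟩
  have h2 : dist x.2 y.2 < y.2 / 8 := (le_max_right _ _).trans_lt hxy
  rw [Real.dist_eq, abs_lt] at h2
  have hx2 : y.2 / 2 ≤ x.2 := by linarith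
  have hx : 0 < x.2 := by linarith
  set v := tentAverage g y
  set S := scaledLIntegral (fun z => ‖g z - g y.1‖ₑ) y (1 / 2) with hS
  have h3 : scaledLIntegral (fun z => ‖g z - v‖ₑ) y (1 / 2) ≤
      (1 + ((1 / 2) ^ d : ℝ).toNNReal * κ * K : ℝ≥0) * S := by
    calc _ ≤ scaledLIntegral (fun z => ‖g z - g y.1‖ₑ + ‖v - g y.1‖ₑ) y (1 / 2) := by
          unfold scaledLIntegral
          gcongr with z
          beta_reduce
          rw [show g z - v = (g z - g y.1) - (v - g y.1) by ring]
          exact enorm_sub_le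
      _ = S + ENNReal.ofReal ((1 / 2) ^ d) * κ * ‖v - g y.1‖ₑ := by
          rw [← hκ', hd, ← volume_ball_mul_inv hy (by norm_num), hS]
          unfold scaledLIntegral
          rw [lintegral_add_right _ measurable_const, setLIntegral_const]
          ring
      _ ≤ S + ENNReal.ofReal ((1 / 2) ^ d) * κ * (K * S) := by
          gcongr
          exact (hK g hg y hy _).trans (by gcongr; exact scaledLIntegral_mono _ hy (by norm_num))
      _ = _ := by
          push_cast
          rw [ENNReal.ofNNReal_toNNReal]
          ring
  rw [tentAverage_sub_tentAverage hg hx hy, enorm_mul]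
  calc _ ≤ ENNReal.ofReal ((c * (y.2 / 2) ^ (d + 1))⁻¹) *
        (ENNReal.ofReal (2 * dist x y) *
          ∫⁻ z in Metric.ball y.1 (1 / 2 * y.2), ‖g z - v‖ₑ) := by
        refine mul_le_mul' ?_ ?_
        · rw [Real.enorm_of_nonneg (inv_nonneg.2 (integral_tent_pos hx).le)]
          refine ENNReal.ofReal_le_ofReal (inv_anti₀ (by positivity) (le_trans ?_ (hcy x hx)))
          gcongr
        · refine (enorm_integral_le_lintegral_enorm _).trans ?_
          rw [← lintegral_const_mul' _ _ ENNReal.ofReal_ne_top,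
            ← lintegral_indicator Metric.isOpen_ball.measurableSet]
          refine lintegral_mono fun z => ?_
          by_cases hz : z ∈ Metric.ball y.1 (1 / 2 * y.2)
          · rw [indicator_of_mem hz, enorm_mul, Real.enorm_eq_ofReal_abs (tent x z - tent y z)]
            gcongr
            exact abs_tent_sub_tent_le x y z
          · simp [tent_sub_tent_eq_zero hxy hz]
    _ = ENNReal.ofReal (c⁻¹ * 2 ^ (d + 2)) * ENNReal.ofReal (dist x y / y.2) *
          scaledLIntegral (fun z => ‖g z - v‖ₑ) y (1 / 2) := by
        unfold scaledLIntegral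
        rw [← mul_assoc, ← mul_assoc, ← ENNReal.ofReal_mul (by positivity),
          ← ENNReal.ofReal_mul (by positivity), ← ENNReal.ofReal_mul (by positivity)]
        congr 2
        rw [← hd, div_pow]
        field_simp
        ring
    _ ≤ _ := by
        push_cast at h3 ⊢
        rw [ENNReal.ofNNReal_toNNReal]
        calc _ ≤ _ := mul_le_mul_right h3 _
          _ = _ := by ring

/-- Hölder's inequality on the ball. The measure of the ball divided by y.2^dim does not depend on
y, so the constant is uniform. -/
theorem scaledLIntegral_rpow_le {p : ℝ} (hp : 1 ≤ p) {r : ℝ} (hr : 0 < r) :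
    ∃ K : ℝ≥0, ∀ f : E → ℝ≥0∞, Measurable f → ∀ y : E × ℝ, 0 < y.2 →
      scaledLIntegral f y r ^ p ≤ K * scaledLIntegral (fun z => f z ^ p) y r := by
  set d := Module.finrank ℝ E with hd
  have hp0 : 0 < p := by linarith
  set κ : ℝ≥0∞ := ENNReal.ofReal (r ^ d) * volume (Metric.ball (0 : E) 1) with hκ
  have hκ' : κ ^ (p - 1) ≠ ∞ := ENNReal.rpow_ne_top_of_nonneg (by linarith)
    (ENNReal.mul_ne_top ENNReal.ofReal_ne_top measure_ball_lt_top.ne)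
  refine ⟨(κ ^ (p - 1)).toNNReal, fun f hf y hy => ?_⟩
  rw [ENNReal.coe_toNNReal hκ', hκ, hd, ← volume_ball_mul_inv hy hr]
  unfold scaledLIntegral
  set A := ENNReal.ofReal ((y.2 ^ Module.finrank ℝ E)⁻¹)
  set μ := volume.restrict (Metric.ball y.1 (r * y.2)) with hμ
  have hA0 : A ≠ 0 := by simp only [A, ne_eq, ENNReal.ofReal_eq_zero, not_le]; positivity
  have h := eLpNorm'_le_eLpNorm'_mul_rpow_measure_univ (μ := μ) one_pos hp
    hf.aestronglyMeasurable
  simp only [eLpNorm', enorm_eq_self, ENNReal.rpow_one, div_one] at h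
  rw [hμ, Measure.restrict_apply_univ] at h
  rw [← hμ] at h
  have h' := ENNReal.rpow_le_rpow h hp0.le
  rw [ENNReal.mul_rpow_of_nonneg _ _ hp0.le, ← ENNReal.rpow_mul, ← ENNReal.rpow_mul,
    one_div_mul_cancel hp0.ne', ENNReal.rpow_one, sub_mul, one_div_mul_cancel hp0.ne',
    one_mul] at h'
  rw [ENNReal.mul_rpow_of_nonneg _ _ hp0.le, ENNReal.mul_rpow_of_nonneg _ _ (by linarith : 0 ≤ p - 1)]
  calc _ ≤ A ^ p * _ := mul_le_mul_right h' _
    _ = _ := by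
      rw [show A ^ p = A ^ (p - 1) * A by
        nth_rw 3 [← ENNReal.rpow_one A]
        rw [← ENNReal.rpow_add _ _ hA0 ENNReal.ofReal_ne_top, sub_add_cancel]]
      ring

theorem measurable_uncurry_scaledLIntegral {f : E → E → ℝ≥0∞}
    (hf : Measurable (Function.uncurry f)) (r : ℝ) :
    Measurable (fun y : E × ℝ => scaledLIntegral (f y.1) y r) := by
  unfold scaledLIntegral
  refine Measurable.mul (by fun_prop) ?_
  simp_rw [← lintegral_indicator Metric.isOpen_ball.measurableSet]
  refine Measurable.lintegral_prod_right ?_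
  have : (Function.uncurry fun (y : E × ℝ) (z : E) =>
      (Metric.ball y.1 (r * y.2)).indicator (fun z => f y.1 z) z) =
      {w : (E × ℝ) × E | dist w.2 w.1.1 < r * w.1.2}.indicator (fun w => f w.1.1 w.2) := by
    ext w
    simp [Function.uncurry, indicator, Metric.mem_ball]
  rw [this]
  refine Measurable.indicator ?_ (measurableSet_lt (by fun_prop) (by fun_prop))
  exact hf.comp ((measurable_fst.comp measurable_fst).prodMk measurable_snd)

theorem measurable_tentAverage {g : E → ℝ} (hg : Measurable g) : Measurable (tentAverage g) := by
  unfold tentAverage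
  have h1 : Measurable (fun x : (E × ℝ) × E => tent x.1 x.2) :=
    continuous_uncurry_tent.measurable
  refine Measurable.mul (Measurable.inv ?_) ?_
  · exact (StronglyMeasurable.integral_prod_right (f := fun y z => tent y z)
      h1.stronglyMeasurable).measurable
  · exact (StronglyMeasurable.integral_prod_right (f := fun y z => tent y z * g z)
      (h1.mul (hg.comp measurable_snd)).stronglyMeasurable).measurable

end Averaging

/-! ### Integration over the strip -/

instance {N : ℕ} : (volume : Measure (FullSpace N)).IsAddHaarMeasure :=
  inferInstanceAs ((volume : Measure (Horiz N)).prod (volume : Measure ℝ)).IsAddHaarMeasure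

theorem finrank_horiz (N : ℕ) : Module.finrank ℝ (Horiz N) = N - 1 := by simp

theorem finrank_fullSpace {N : ℕ} (hN : 2 ≤ N) : Module.finrank ℝ (FullSpace N) = N := by
  rw [Module.finrank_prod, finrank_horiz, Module.finrank_self]; omega

theorem enorm_rpow_eq_ofReal (a : ℝ) {p : ℝ} (hp : 0 ≤ p) :
    ‖a‖ₑ ^ p = ENNReal.ofReal (|a| ^ p) := by
  rw [Real.enorm_eq_ofReal_abs, ENNReal.ofReal_rpow_of_nonneg (abs_nonneg a) hp]

theorem measurableSet_stripDomain {N : ℕ} {η : Horiz N → ℝ} (hη : Measurable η) :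
    MeasurableSet (stripDomain η) :=
  (measurableSet_lt measurable_const measurable_snd).inter
    (measurableSet_lt measurable_snd (hη.comp measurable_fst))

theorem setLIntegral_stripDomain {N : ℕ} {η : Horiz N → ℝ} (hη : Measurable η)
    {f : FullSpace N → ℝ≥0∞} (hf : Measurable f) :
    ∫⁻ x in stripDomain η, f x = ∫⁻ x, ∫⁻ t in Ioo 0 (η x), f (x, t) := by
  rw [← lintegral_indicator (measurableSet_stripDomain hη), Measure.volume_eq_prod,
    lintegral_prod _ (hf.indicator (measurableSet_stripDomain hη)).aemeasurable]
  refine lintegral_congr fun x => ?_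
  rw [← lintegral_indicator measurableSet_Ioo]
  rfl

/-- The heights become the inner variables, so they can be integrated out for a fixed pair of
horizontal points. -/
theorem setLIntegral_stripDomain_prod {N : ℕ} {η : Horiz N → ℝ} (hη : Measurable η)
    {f : FullSpace N → FullSpace N → ℝ≥0∞} (hf : Measurable (Function.uncurry f)) :
    ∫⁻ x in stripDomain η, ∫⁻ y in stripDomain η, f x y =
      ∫⁻ x, ∫⁻ y, ∫⁻ t in Ioo 0 (η x), ∫⁻ τ in Ioo 0 (η y), f (x, t) (y, τ) := by
  have hm : Measurable fun x => ∫⁻ y in stripDomain η, f x y := hf.lintegral_prod_right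
  rw [setLIntegral_stripDomain hη hm]
  refine lintegral_congr fun x => ?_
  have h1 : ∀ t : ℝ, ∫⁻ y in stripDomain η, f (x, t) y =
      ∫⁻ y, ∫⁻ τ in Ioo 0 (η y), f (x, t) (y, τ) := fun t =>
    setLIntegral_stripDomain hη (hf.comp (measurable_const.prodMk measurable_id))
  simp_rw [h1]
  refine lintegral_lintegral_swap (Measurable.aemeasurable ?_)
  simp_rw [← lintegral_indicator measurableSet_Ioo, Function.uncurry_def]
  refine Measurable.lintegral_prod_right ?_
  have : (Function.uncurry fun (w : ℝ × Horiz N) (τ : ℝ) =>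
      (Ioo 0 (η w.2)).indicator (fun τ => f (x, w.1) (w.2, τ)) τ) =
      {w : (ℝ × Horiz N) × ℝ | 0 < w.2 ∧ w.2 < η w.1.2}.indicator
        (fun w => Function.uncurry f ((x, w.1.1), (w.1.2, w.2))) := by
    ext w
    simp [Function.uncurry, indicator]
  rw [this]
  refine Measurable.indicator (hf.comp (by fun_prop)) ?_
  exact (measurableSet_lt measurable_const measurable_snd).inter
    (measurableSet_lt measurable_snd (hη.comp (by fun_prop)))

/-! ### Integrals of the three kinds of terms -/

section Kernel

variable {N : ℕ} {s p : ℝ}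

theorem setLIntegral_truncKernel_mul_le (hN : 2 ≤ N) (hsp0 : 0 < s * p) (hspp : s * p < p) :
    ∃ K : ℝ≥0, ∀ (Ω : Set (FullSpace N)) (T : FullSpace N → ℝ) (a : FullSpace N → ℝ≥0∞),
      MeasurableSet Ω → (∀ x ∈ Ω, 0 < T x) →
      ∫⁻ x in Ω, ∫⁻ y in Ω, truncKernel p (N + s * p) (T x) (dist x y) * a x ≤
        K * ∫⁻ x in Ω, ENNReal.ofReal (T x ^ (-(s * p))) * a x := by
  have : Nontrivial (FullSpace N) := Module.nontrivial_of_finrank_pos (R := ℝ)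
    (by rw [finrank_fullSpace hN]; omega)
  obtain ⟨K, hK⟩ := lintegral_truncKernel_le (volume : Measure (FullSpace N))
    (p := p) (q := N + s * p) (by rw [finrank_fullSpace hN]; linarith)
    (by rw [finrank_fullSpace hN]; linarith)
  rw [finrank_fullSpace hN, sub_add_cancel_left] at hK
  refine ⟨K, fun Ω T a hΩ hT => ?_⟩
  rw [← lintegral_const_mul' _ _ ENNReal.coe_ne_top]
  refine setLIntegral_mono' hΩ fun x hx => ?_
  have hm : Measurable fun y : FullSpace N => truncKernel p (N + s * p) (T x) (dist y x) :=
    measurable_const.truncKernel (measurable_id.dist measurable_const)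
  simp_rw [dist_comm x]
  rw [lintegral_mul_const _ hm, ← mul_assoc]
  exact mul_le_mul_left ((setLIntegral_le_lintegral _ _).trans (hK (T x) (hT x hx) x)) _

/-- The scaled oscillation `t^{1-N} ∫_{B(x', t/2)} |g(z) - g(x')|^p dz` at `(x', t)`. -/
noncomputable def scaledOsc (p : ℝ) (g : Horiz N → ℝ) (y : FullSpace N) : ℝ≥0∞ :=
  scaledLIntegral (fun z => ‖g z - g y.1‖ₑ ^ p) y (1 / 2)

theorem measurable_scaledOsc {g : Horiz N → ℝ} (hg : Measurable g) :
    Measurable (scaledOsc p g) :=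
  measurable_uncurry_scaledLIntegral (f := fun y z => ‖g z - g y‖ₑ ^ p) (by fun_prop) (1 / 2)

/-- By Fubini, a point z enters the ball at height t exactly when t > 2‖z - y‖. Integrating t^{-β}
from there on gives a multiple of ‖z - y‖^{1-β}, which is the near kernel; t < h confines z to the
ball of radius h/2. -/
theorem lintegral_Ioo_scaledOsc_le (hN : 2 ≤ N) (hp : 0 < p) (hsp : 1 < s * p) :
    ∃ K : ℝ≥0, ∀ (g : Horiz N → ℝ), Measurable g → ∀ (y : Horiz N) (h : ℝ),
      ∫⁻ t in Ioo 0 h, ENNReal.ofReal (t ^ (-(s * p))) * scaledOsc p g (y, t) ≤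
        K * ∫⁻ z in Metric.ball y (h / 2),
          ENNReal.ofReal (|g y - g z| ^ p / ‖y - z‖ ^ ((N : ℝ) - 2 + s * p)) := by
  have hN' : ((N - 1 : ℕ) : ℝ) = N - 1 := by rw [Nat.cast_sub (by omega), Nat.cast_one]
  have hN2 : (2 : ℝ) ≤ N := by exact_mod_cast hN
  set β : ℝ := s * p + (N - 1) with hβ
  have hβ1 : 0 < β - 1 := by linarith
  refine ⟨(2 ^ (1 - β) / (β - 1)).toNNReal, fun g hg y h => ?_⟩
  have hG : Measurable fun z => ‖g z - g y‖ₑ ^ p := by fun_prop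
  set F : ℝ → Horiz N → ℝ≥0∞ := fun t z =>
    {w : ℝ × Horiz N | dist w.2 y < 1 / 2 * w.1}.indicator
      (fun w => ENNReal.ofReal (w.1 ^ (-β)) * ‖g w.2 - g y‖ₑ ^ p) (t, z) with hF
  have hFm : Measurable (Function.uncurry F) := by
    refine Measurable.indicator ?_ (measurableSet_lt (by fun_prop) (by fun_prop))
    fun_prop
  have h1 : ∀ t ∈ Ioo 0 h, ENNReal.ofReal (t ^ (-(s * p))) * scaledOsc p g (y, t) =
      ∫⁻ z in Metric.ball y (h / 2), F t z := by
    intro t ht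
    rw [scaledOsc, scaledLIntegral, ← mul_assoc, ← ENNReal.ofReal_mul (Real.rpow_nonneg ht.1.le _)]
    simp only
    rw [← lintegral_const_mul _ hG, ← lintegral_indicator Metric.isOpen_ball.measurableSet,
      ← lintegral_indicator Metric.isOpen_ball.measurableSet]
    refine lintegral_congr fun z => ?_
    have hpow : t ^ (-(s * p)) * (t ^ Module.finrank ℝ (Horiz N))⁻¹ = t ^ (-β) := by
      rw [finrank_horiz, ← Real.rpow_natCast, hN', ← Real.rpow_neg ht.1.le,
        ← Real.rpow_add ht.1]
      congr 1; rw [hβ]; ring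
    rw [hpow]
    by_cases hz : dist z y < 1 / 2 * t
    · have hz' : dist z y < h / 2 := by linarith [ht.2]
      simp [hF, indicator, hz', show dist z y < 2⁻¹ * t by linarith]
    · simp [hF, indicator, show ¬ dist z y < 2⁻¹ * t by norm_num at hz ⊢; linarith]
  rw [setLIntegral_congr_fun measurableSet_Ioo h1, lintegral_lintegral_swap hFm.aemeasurable,
    ← lintegral_const_mul' _ _ ENNReal.coe_ne_top]
  refine lintegral_mono fun z => ?_
  rcases eq_or_ne z y with rfl | hzy
  · simp [hF, hp, indicator]
  have hρ : 0 < dist z y := dist_pos.2 hzy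
  calc ∫⁻ t in Ioo 0 h, F t z
      ≤ ∫⁻ t in Ioi (2 * dist z y), ENNReal.ofReal (t ^ (-β)) * ‖g z - g y‖ₑ ^ p := by
        refine (setLIntegral_le_lintegral _ _).trans ?_
        rw [← lintegral_indicator measurableSet_Ioi]
        refine lintegral_mono fun t => ?_
        by_cases hz : dist z y < 1 / 2 * t
        · simp [hF, indicator, show dist z y < 2⁻¹ * t by linarith,
            show 2 * dist z y < t by linarith]
        · simp [hF, indicator, show ¬ dist z y < 2⁻¹ * t by norm_num at hz ⊢; linarith]
    _ = ENNReal.ofReal ((2 * dist z y) ^ (1 - β) / (β - 1)) * ‖g z - g y‖ₑ ^ p := by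
        rw [lintegral_mul_const _ (by fun_prop), lintegral_Ioi_rpow_neg (by linarith) (by positivity)]
    _ = _ := by
        rw [enorm_rpow_eq_ofReal _ hp.le, ENNReal.ofNNReal_toNNReal,
          ← ENNReal.ofReal_mul (by positivity), ← ENNReal.ofReal_mul (by positivity),
          Real.mul_rpow (by norm_num) hρ.le, abs_sub_comm, dist_eq_norm, norm_sub_rev z y,
          show (N : ℝ) - 2 + s * p = -(1 - β) by rw [hβ]; ring, Real.rpow_neg (norm_nonneg _)]
        congr 1
        rw [div_inv_eq_mul]
        ring

theorem setLIntegral_scaledOsc_le (hN : 2 ≤ N) (hp : 0 < p) (hsp : 1 < s * p) :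
    ∃ K : ℝ≥0, ∀ (η g : Horiz N → ℝ), Measurable η → Measurable g →
      ∫⁻ y in stripDomain η, ENNReal.ofReal (y.2 ^ (-(s * p))) * scaledOsc p g y ≤
        K * nearEnergy s p η g := by
  obtain ⟨K, hK⟩ := lintegral_Ioo_scaledOsc_le hN hp hsp
  refine ⟨K, fun η g hη hg => ?_⟩
  have hm : Measurable fun y : FullSpace N =>
      ENNReal.ofReal (y.2 ^ (-(s * p))) * scaledOsc p g y :=
    Measurable.mul (by fun_prop) (measurable_scaledOsc hg)
  rw [setLIntegral_stripDomain hη hm,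
    nearEnergy, ← lintegral_const_mul' _ _ ENNReal.coe_ne_top]
  exact lintegral_mono fun y => hK g hg y (η y)

/-- The kernel `δ^{-q}`, cut off where `δ` is small compared to the heights `t` and `τ`. -/
noncomputable def farKernel (q t τ δ : ℝ) : ℝ≥0∞ :=
  if t ≤ 9 * δ ∧ τ ≤ 9 * δ then ENNReal.ofReal (δ ^ (-q)) else 0

theorem measurable_farKernel (q : ℝ) :
    Measurable fun w : FullSpace N × FullSpace N => farKernel q w.1.2 w.2.2 (dist w.1 w.2) := by
  unfold farKernel
  refine Measurable.ite ?_ (by fun_prop) measurable_const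
  refine MeasurableSet.inter (s₁ := {w : FullSpace N × FullSpace N | w.1.2 ≤ 9 * dist w.1 w.2})
    (s₂ := {w : FullSpace N × FullSpace N | w.2.2 ≤ 9 * dist w.1 w.2}) ?_ ?_ <;>
  exact measurableSet_le (by fun_prop) (by fun_prop)

/-- On the support, δ dominates ρ, t/9 and τ/9. Splitting δ^{-q} into two equal powers decouples the
two heights, each left with a kernel of exponent q/2. -/
theorem farKernel_le_mul {q t τ δ ρ : ℝ} (hq : 0 ≤ q) (hρ : 0 < ρ) (hδ : ρ ≤ δ) :
    farKernel q t τ δ ≤ ENNReal.ofReal ((max ρ (t / 9)) ^ (-(q / 2))) *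
      ENNReal.ofReal ((max ρ (τ / 9)) ^ (-(q / 2))) := by
  unfold farKernel
  split_ifs with h
  · have hδ0 : 0 < δ := hρ.trans_le hδ
    rw [← ENNReal.ofReal_mul (by positivity)]
    refine ENNReal.ofReal_le_ofReal ?_
    calc δ ^ (-q) = δ ^ (-(q / 2)) * δ ^ (-(q / 2)) := by
          rw [← Real.rpow_add hδ0]; congr 1; ring
      _ ≤ _ := by
          refine mul_le_mul ?_ ?_ (by positivity) (by positivity)
          · exact Real.rpow_le_rpow_of_nonpos (by positivity) (max_le hδ (by linarith [h.1]))
              (by linarith)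
          · exact Real.rpow_le_rpow_of_nonpos (by positivity) (max_le hδ (by linarith [h.2]))
              (by linarith)
  · exact zero_le

theorem setLIntegral_farKernel_le (hN : 2 ≤ N) (hp : 0 < p) (hsp : 1 < s * p) :
    ∃ K : ℝ≥0, ∀ (η g : Horiz N → ℝ), Measurable η → (∀ x, 0 < η x) → Measurable g →
      ∫⁻ x in stripDomain η, ∫⁻ y in stripDomain η,
        farKernel (N + s * p) x.2 y.2 (dist x y) * ‖g x.1 - g y.1‖ₑ ^ p ≤
      K * (nearEnergy s p η g + farEnergy s p η g) := by
  have hN2 : (2 : ℝ) ≤ N := by exact_mod_cast hN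
  set q : ℝ := N + s * p with hq
  obtain ⟨K, hK⟩ := lintegral_Ioi_max_rpow_neg_le (a := q / 2) (M := 9) (by linarith) (by norm_num)
  refine ⟨K * K + 1, fun η g hη hη0 hg => ?_⟩
  rw [setLIntegral_stripDomain_prod hη]
  swap
  · exact (measurable_farKernel q).mul (by fun_prop)
  -- Inside the ball each height integral yields ρ^{1-q/2}, in total ρ^{2-q}. Outside, δ ≥ ρ
  -- suffices and the height intervals contribute their lengths η(x) and η(y).
  have key : ∀ x : Horiz N, ∫⁻ y, ∫⁻ t in Ioo 0 (η x), ∫⁻ τ in Ioo 0 (η y),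
      farKernel q t τ (dist (x, t) (y, τ)) * ‖g x - g y‖ₑ ^ p ≤
      (K * K : ℝ≥0) * (∫⁻ y in Metric.ball x (η x / 2),
        ENNReal.ofReal (|g x - g y| ^ p / ‖x - y‖ ^ ((N : ℝ) - 2 + s * p))) +
      ∫⁻ y in (Metric.ball x (η x / 2))ᶜ,
        ENNReal.ofReal (η x * η y * (|g x - g y| ^ p / ‖x - y‖ ^ q)) := by
    intro x
    rw [← lintegral_add_compl _ (Metric.isOpen_ball (x := x) (ε := η x / 2)).measurableSet,
      ← lintegral_const_mul' _ _ ENNReal.coe_ne_top]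
    refine add_le_add (lintegral_mono fun y => ?_) ?_
    · rcases eq_or_ne x y with rfl | hxy
      · simp [hp]
      have hρ : 0 < ‖x - y‖ := norm_pos_iff.2 (sub_ne_zero.2 hxy)
      calc _ ≤ ∫⁻ t in Ioo 0 (η x), ∫⁻ τ in Ioo 0 (η y),
            ENNReal.ofReal ((max ‖x - y‖ (t / 9)) ^ (-(q / 2))) *
              ENNReal.ofReal ((max ‖x - y‖ (τ / 9)) ^ (-(q / 2))) * ‖g x - g y‖ₑ ^ p := by
            gcongr with t τ
            refine farKernel_le_mul (by linarith) hρ ?_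
            rw [← dist_eq_norm]
            exact le_max_left _ _
        _ = (∫⁻ t in Ioo 0 (η x), ENNReal.ofReal ((max ‖x - y‖ (t / 9)) ^ (-(q / 2)))) *
              (∫⁻ τ in Ioo 0 (η y), ENNReal.ofReal ((max ‖x - y‖ (τ / 9)) ^ (-(q / 2)))) *
              ‖g x - g y‖ₑ ^ p := by
            have hm : Measurable fun t : ℝ =>
              ENNReal.ofReal ((max ‖x - y‖ (t / 9)) ^ (-(q / 2))) := by fun_prop
            rw [← lintegral_mul_const _ hm, ← lintegral_mul_const _ (hm.mul_const _)]
            refine lintegral_congr fun t => ?_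
            rw [lintegral_mul_const _ (hm.const_mul _), lintegral_const_mul _ hm]
        _ ≤ (K * ENNReal.ofReal (‖x - y‖ ^ (1 - q / 2))) *
              (K * ENNReal.ofReal (‖x - y‖ ^ (1 - q / 2))) * ‖g x - g y‖ₑ ^ p := by
            gcongr
            · exact (lintegral_mono_set Ioo_subset_Ioi_self).trans (hK _ hρ)
            · exact (lintegral_mono_set Ioo_subset_Ioi_self).trans (hK _ hρ)
        _ = _ := by
            rw [enorm_rpow_eq_ofReal _ hp.le, mul_mul_mul_comm, mul_assoc,
              ← ENNReal.ofReal_mul (by positivity), ← ENNReal.ofReal_mul (by positivity),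
              ← Real.rpow_add hρ, ENNReal.coe_mul]
            congr 2
            rw [div_eq_mul_inv _ (‖x - y‖ ^ _), ← Real.rpow_neg hρ.le, mul_comm]
            congr 2
            rw [hq]; ring
    · refine setLIntegral_mono' Metric.isOpen_ball.measurableSet.compl fun y hy => ?_
      have hρ : 0 < ‖x - y‖ := by
        rw [mem_compl_iff, Metric.mem_ball, not_lt, dist_comm, dist_eq_norm] at hy
        linarith [hη0 x]
      calc _ ≤ ∫⁻ t in Ioo 0 (η x), ∫⁻ τ in Ioo 0 (η y),
            ENNReal.ofReal (‖x - y‖ ^ (-q)) * ‖g x - g y‖ₑ ^ p := by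
            gcongr with t τ
            unfold farKernel
            split_ifs
            · refine ENNReal.ofReal_le_ofReal (Real.rpow_le_rpow_of_nonpos hρ ?_ (by linarith))
              rw [← dist_eq_norm]
              exact le_max_left _ _
            · exact zero_le
        _ = _ := by
            rw [setLIntegral_const, setLIntegral_const, Real.volume_Ioo, Real.volume_Ioo,
              enorm_rpow_eq_ofReal _ hp.le, ← ENNReal.ofReal_mul (by positivity),
              sub_zero, sub_zero, ← ENNReal.ofReal_mul (by positivity),
              ← ENNReal.ofReal_mul (mul_nonneg (by positivity) (hη0 y).le)]
            congr 1
            rw [div_eq_mul_inv, ← Real.rpow_neg hρ.le]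
            ring
  refine (lintegral_mono key).trans ?_
  have hm : Measurable fun x : Horiz N => ∫⁻ y in Metric.ball x (η x / 2),
        ENNReal.ofReal (|g x - g y| ^ p / ‖x - y‖ ^ ((N : ℝ) - 2 + s * p)) := by
    simp_rw [← lintegral_indicator Metric.isOpen_ball.measurableSet]
    refine Measurable.lintegral_prod_right ?_
    have : (Function.uncurry fun (x y : Horiz N) => (Metric.ball x (η x / 2)).indicator
        (fun y => ENNReal.ofReal (|g x - g y| ^ p / ‖x - y‖ ^ ((N : ℝ) - 2 + s * p))) y) =
        {w : Horiz N × Horiz N | dist w.2 w.1 < η w.1 / 2}.indicator (fun w =>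
          ENNReal.ofReal (|g w.1 - g w.2| ^ p / ‖w.1 - w.2‖ ^ ((N : ℝ) - 2 + s * p))) := by
      ext w
      simp [Function.uncurry, indicator]
    rw [this]
    refine Measurable.indicator ?_ (measurableSet_lt (by fun_prop) (by fun_prop))
    fun_prop
  rw [lintegral_add_left (hm.const_mul _), lintegral_const_mul' _ _ ENNReal.coe_ne_top, mul_add]
  change _ * nearEnergy s p η g + farEnergy s p η g ≤ _
  gcongr
  · exact le_self_add
  · refine le_mul_of_one_le_left zero_le ?_
    exact_mod_cast le_add_self

end Kernel

/-! ### Pointwise bounds for differences of the extension -/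

section Pointwise

variable {N : ℕ} {s p q : ℝ}

theorem truncKernel_eq_mul {T δ : ℝ} (hp : 0 ≤ p) (hT : 0 < T) (hδ : 0 ≤ δ) :
    truncKernel p q T δ = ENNReal.ofReal (min 1 (δ / T)) ^ p * ENNReal.ofReal (δ ^ (-q)) := by
  have h : 0 ≤ min 1 (δ / T) := le_min zero_le_one (by positivity)
  rw [truncKernel, ENNReal.ofReal_mul (by positivity), ENNReal.ofReal_rpow_of_nonneg h hp]

theorem ofReal_rpow_neg_le_truncKernel {T δ M : ℝ} (hp : 0 ≤ p) (hT : 0 < T) (hM : 1 ≤ M)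
    (h : T ≤ M * δ) :
    ENNReal.ofReal (δ ^ (-q)) ≤ ENNReal.ofReal M ^ p * truncKernel p q T δ := by
  have hM0 : 0 < M := by linarith
  have hδ : 0 < δ := by
    by_contra h0
    nlinarith
  rw [truncKernel_eq_mul hp hT hδ.le, ← mul_assoc, ← ENNReal.mul_rpow_of_nonneg _ _ hp,
    ← ENNReal.ofReal_mul hM0.le]
  refine le_mul_of_one_le_left zero_le ?_
  refine (ENNReal.one_rpow p).symm.le.trans (ENNReal.rpow_le_rpow ?_ hp)
  rw [ENNReal.one_le_ofReal, mul_min_of_nonneg _ _ hM0.le, mul_one]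
  refine le_min hM ?_
  rw [← mul_div_assoc, one_le_div hT]
  exact h

theorem truncKernel_anti {T T' δ : ℝ} (hp : 0 ≤ p) (hT : 0 < T) (hTT' : T ≤ T') (hδ : 0 ≤ δ) :
    truncKernel p q T' δ ≤ truncKernel p q T δ := by
  rw [truncKernel_eq_mul hp hT hδ, truncKernel_eq_mul hp (hT.trans_le hTT') hδ]
  gcongr

theorem enorm_tentAverage_sub_rpow_le (hp : 1 ≤ p) :
    ∃ K : ℝ≥0, ∀ g : Horiz N → ℝ, Measurable g → LocallyIntegrable g →
      ∀ y : FullSpace N, 0 < y.2 → ‖tentAverage g y - g y.1‖ₑ ^ p ≤ K * scaledOsc p g y := by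
  have hp0 : 0 ≤ p := by linarith
  obtain ⟨K₁, h₁⟩ := enorm_tentAverage_sub_le (E := Horiz N)
  obtain ⟨K₂, h₂⟩ := scaledLIntegral_rpow_le (E := Horiz N) hp (r := 1 / 2) (by norm_num)
  refine ⟨K₁ ^ p * K₂, fun g hg hgi y hy => ?_⟩
  calc _ ≤ (K₁ * scaledLIntegral (fun z => ‖g z - g y.1‖ₑ) y (1 / 2)) ^ p := by
        gcongr
        exact (h₁ g hgi y hy _).trans (by gcongr; exact scaledLIntegral_mono _ hy (by norm_num))
    _ ≤ K₁ ^ p * (K₂ * scaledOsc p g y) := by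
        rw [ENNReal.mul_rpow_of_nonneg _ _ hp0]
        gcongr
        exact h₂ _ (by fun_prop) y hy
    _ = _ := by
        rw [ENNReal.coe_mul, ENNReal.coe_rpow_of_nonneg _ hp0, mul_assoc]

theorem enorm_tentAverage_sub_tentAverage_rpow_le (hp : 1 ≤ p) :
    ∃ K : ℝ≥0, ∀ g : Horiz N → ℝ, Measurable g → LocallyIntegrable g →
      ∀ x y : FullSpace N, 0 < x.2 → 0 < y.2 →
        ‖tentAverage g x - tentAverage g y‖ₑ ^ p * ENNReal.ofReal (dist x y ^ (-q)) ≤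
          K * (truncKernel p q y.2 (dist x y) * scaledOsc p g y +
            truncKernel p q x.2 (dist x y) * scaledOsc p g x +
            farKernel q x.2 y.2 (dist x y) * ‖g x.1 - g y.1‖ₑ ^ p) := by
  have hp0 : 0 ≤ p := by linarith
  obtain ⟨K₁, h₁⟩ := enorm_tentAverage_sub_tentAverage_le (E := Horiz N)
  obtain ⟨K₂, h₂⟩ := scaledLIntegral_rpow_le (E := Horiz N) hp (r := 1 / 2) (by norm_num)
  obtain ⟨K₃, h₃⟩ := enorm_tentAverage_sub_rpow_le (N := N) hp
  set c : ℝ≥0 := 2 ^ (p - 1) with hc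
  have hc1 : 1 ≤ c := NNReal.one_le_rpow (by norm_num) (by linarith)
  have hc' : (2 : ℝ≥0∞) ^ (p - 1) = c := by
    rw [hc, ENNReal.coe_rpow_of_nonneg _ (by linarith)]; rfl
  refine ⟨max (K₁ ^ p * K₂) (c * c * (9 ^ p * K₃ + 1)), fun g hg hgi x y hx hy => ?_⟩
  -- For δ < y.2/8 the increment estimate for tent averages applies and the first term suffices. For
  -- δ ≥ y.2/8 the triangle inequality passes through `g x.1` and `g y.1`.
  set δ := dist x y with hδ
  have hδ0 : 0 ≤ δ := dist_nonneg
  rcases lt_or_ge δ (y.2 / 8) with h | h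
  · have hS := h₂ (fun z => ‖g z - g y.1‖ₑ) (by fun_prop) y hy
    have hmin : min 1 (δ / y.2) = δ / y.2 := min_eq_right (by rw [div_le_one hy]; linarith)
    calc _ ≤ (K₁ * ENNReal.ofReal (δ / y.2) *
          scaledLIntegral (fun z => ‖g z - g y.1‖ₑ) y (1 / 2)) ^ p *
            ENNReal.ofReal (δ ^ (-q)) := by
          gcongr
          exact h₁ g hgi x y hy h
      _ ≤ K₁ ^ p * ENNReal.ofReal (δ / y.2) ^ p * (K₂ * scaledOsc p g y) *
            ENNReal.ofReal (δ ^ (-q)) := by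
          rw [ENNReal.mul_rpow_of_nonneg _ _ hp0, ENNReal.mul_rpow_of_nonneg _ _ hp0]
          gcongr
          exact hS
      _ = (K₁ ^ p * K₂ : ℝ≥0) * (truncKernel p q y.2 δ * scaledOsc p g y) := by
          rw [truncKernel_eq_mul hp0 hy hδ0, hmin, ENNReal.coe_mul,
            ENNReal.coe_rpow_of_nonneg _ hp0]
          ring
      _ ≤ _ := by
          gcongr
          · exact le_max_left _ _
          · rw [add_assoc]; exact le_self_add
  · have hxy : x.2 ≤ y.2 + δ := by
      have h2 : dist x.2 y.2 ≤ δ := le_max_right _ _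
      rw [Real.dist_eq] at h2
      linarith [le_abs_self (x.2 - y.2)]
    -- This is the source of the constant 9: y.2 ≤ 8δ, and the heights differ by at most δ.
    have hx9 : x.2 ≤ 9 * δ := by linarith
    have hy9 : y.2 ≤ 9 * δ := by linarith
    have h9 : ENNReal.ofReal 9 ^ p = ((9 ^ p : ℝ≥0) : ℝ≥0∞) := by
      rw [ENNReal.coe_rpow_of_nonneg _ hp0]; norm_num
    have hWx := ofReal_rpow_neg_le_truncKernel (q := q) hp0 hx (by norm_num) hx9
    have hWy := ofReal_rpow_neg_le_truncKernel (q := q) hp0 hy (by norm_num) hy9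
    have hf : farKernel q x.2 y.2 δ = ENNReal.ofReal (δ ^ (-q)) := if_pos ⟨hx9, hy9⟩
    rw [h9] at hWx hWy
    rw [hf]
    set D := ENNReal.ofReal (δ ^ (-q))
    set G := ‖g x.1 - g y.1‖ₑ ^ p
    have htri : ‖tentAverage g x - tentAverage g y‖ₑ ≤
        ‖tentAverage g y - g y.1‖ₑ + (‖tentAverage g x - g x.1‖ₑ + ‖g x.1 - g y.1‖ₑ) := by
      rw [show tentAverage g x - tentAverage g y = (tentAverage g x - g x.1 + (g x.1 - g y.1)) -
        (tentAverage g y - g y.1) by ring]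
      refine enorm_sub_le.trans ?_
      rw [add_comm]
      gcongr
      exact enorm_add_le _ _
    calc _ ≤ (‖tentAverage g y - g y.1‖ₑ +
          (‖tentAverage g x - g x.1‖ₑ + ‖g x.1 - g y.1‖ₑ)) ^ p * D := by gcongr
      _ ≤ c * (‖tentAverage g y - g y.1‖ₑ ^ p + c * (‖tentAverage g x - g x.1‖ₑ ^ p + G)) * D := by
          gcongr
          rw [← hc']
          refine (ENNReal.rpow_add_le_mul_rpow_add_rpow _ _ hp).trans ?_
          gcongr
          exact ENNReal.rpow_add_le_mul_rpow_add_rpow _ _ hp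
      _ ≤ c * (c * (K₃ * scaledOsc p g y) + c * (K₃ * scaledOsc p g x + G)) * D := by
          gcongr
          · refine (h₃ g hg hgi y hy).trans (le_mul_of_one_le_left zero_le ?_)
            exact_mod_cast hc1
          · exact h₃ g hg hgi x hx
      _ = c * c * (K₃ * (D * scaledOsc p g y) + K₃ * (D * scaledOsc p g x) + D * G) := by ring
      _ ≤ c * c * (K₃ * ((9 ^ p : ℝ≥0) * truncKernel p q y.2 δ * scaledOsc p g y) +
            K₃ * ((9 ^ p : ℝ≥0) * truncKernel p q x.2 δ * scaledOsc p g x) + D * G) := by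
          gcongr
      _ ≤ (c * c * (9 ^ p * K₃ + 1) : ℝ≥0) * (truncKernel p q y.2 δ * scaledOsc p g y +
            truncKernel p q x.2 δ * scaledOsc p g x + D * G) := by
          rw [ENNReal.coe_mul, ENNReal.coe_mul, mul_assoc (c * c : ℝ≥0∞)]
          gcongr
          rw [mul_add, mul_add]
          gcongr ?_ + ?_ + ?_
          · rw [mul_assoc, ← mul_assoc, mul_comm (K₃ : ℝ≥0∞)]
            gcongr
            exact_mod_cast le_self_add
          · rw [mul_assoc, ← mul_assoc, mul_comm (K₃ : ℝ≥0∞)]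
            gcongr
            exact_mod_cast le_self_add
          · refine le_mul_of_one_le_left zero_le ?_
            exact_mod_cast le_add_self
      _ ≤ _ := by
          gcongr
          exact le_max_right _ _

/-- The cutoff equal to `1` on the lower boundary and `0` on the upper half of the strip. -/
noncomputable def stripCutoff (η : Horiz N → ℝ) (x : FullSpace N) : ℝ :=
  max 0 (1 - 2 * (x.2 / η x.1))

/-- The extension of `g`: its tent averages at scale `x_N`, multiplied by the cutoff. -/
noncomputable def stripExtension (η g : Horiz N → ℝ) (x : FullSpace N) : ℝ :=
  stripCutoff η x * tentAverage g x

theorem stripCutoff_nonneg (η : Horiz N → ℝ) (x : FullSpace N) : 0 ≤ stripCutoff η x :=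
  le_max_left _ _

theorem stripCutoff_le_one {η : Horiz N → ℝ} {x : FullSpace N} (hx : x ∈ stripDomain η) :
    stripCutoff η x ≤ 1 := by
  have : 0 < η x.1 := hx.1.trans hx.2
  have : 0 ≤ x.2 / η x.1 := div_nonneg hx.1.le this.le
  exact max_le zero_le_one (by linarith)

theorem abs_stripCutoff_sub_le {L : ℝ≥0} {η : Horiz N → ℝ} (hη : LipschitzWith L η)
    {x y : FullSpace N} (hx : x ∈ stripDomain η) (hy : y ∈ stripDomain η) :
    |stripCutoff η x - stripCutoff η y| ≤ 2 * (1 + L) * min 1 (dist x y / η y.1) := by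
  have hηx : 0 < η x.1 := hx.1.trans hx.2
  have hηy : 0 < η y.1 := hy.1.trans hy.2
  have hL : (0 : ℝ) ≤ L := L.2
  rw [mul_min_of_nonneg _ _ (by positivity)]
  refine le_min ?_ ?_
  · rw [abs_le]
    constructor <;>
    linarith [stripCutoff_nonneg η x, stripCutoff_nonneg η y, stripCutoff_le_one hx,
      stripCutoff_le_one hy]
  · have h1 : dist (η x.1) (η y.1) ≤ L * dist x y :=
      (hη.dist_le_mul _ _).trans (by gcongr; exact le_max_left _ _)
    have h2 : dist x.2 y.2 ≤ dist x y := le_max_right _ _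
    rw [Real.dist_eq] at h1 h2
    -- In this form only η(y.1) stays in the denominator; the variation of η is multiplied by the
    -- ratio x.2 / η x.1 ≤ 1.
    have h3 : x.2 / η x.1 - y.2 / η y.1 =
        ((x.2 - y.2) - x.2 / η x.1 * (η x.1 - η y.1)) / η y.1 := by
      field_simp
      ring
    have h4 : |x.2 / η x.1| ≤ 1 := by
      rw [abs_of_nonneg (div_nonneg hx.1.le hηx.le), div_le_one hηx]
      exact hx.2.le
    have h5 : |x.2 / η x.1 - y.2 / η y.1| ≤ (1 + L) * dist x y / η y.1 := by
      rw [h3, abs_div, abs_of_pos hηy]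
      gcongr
      refine (abs_sub _ _).trans ?_
      rw [abs_mul]
      have := mul_le_mul h4 h1 (abs_nonneg _) zero_le_one
      linarith
    unfold stripCutoff
    refine (abs_max_sub_max_le_max _ _ _ _).trans ?_
    rw [sub_self, abs_zero, max_eq_right (abs_nonneg _)]
    rw [show 1 - 2 * (x.2 / η x.1) - (1 - 2 * (y.2 / η y.1)) =
      -(2 * (x.2 / η x.1 - y.2 / η y.1)) by ring, abs_neg, abs_mul, abs_two]
    calc _ ≤ 2 * ((1 + L) * dist x y / η y.1) := by gcongr
      _ = _ := by ring

theorem enorm_stripExtension_sub_rpow_le (hp : 1 ≤ p) (L : ℝ≥0) :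
    ∃ K : ℝ≥0, ∀ η g : Horiz N → ℝ, LipschitzWith L η → Measurable g → LocallyIntegrable g →
      ∀ x ∈ stripDomain η, ∀ y ∈ stripDomain η,
        ‖stripExtension η g x - stripExtension η g y‖ₑ ^ p *
            ENNReal.ofReal (dist x y ^ (-q)) ≤
          K * ((truncKernel p q y.2 (dist x y) * scaledOsc p g y +
            truncKernel p q (η y.1) (dist x y) * ‖g y.1‖ₑ ^ p) +
            (truncKernel p q x.2 (dist x y) * scaledOsc p g x +
            farKernel q x.2 y.2 (dist x y) * ‖g x.1 - g y.1‖ₑ ^ p)) := by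
  have hp0 : 0 ≤ p := by linarith
  obtain ⟨K₁, h₁⟩ := enorm_tentAverage_sub_tentAverage_rpow_le (N := N) (q := q) hp
  obtain ⟨K₃, h₃⟩ := enorm_tentAverage_sub_rpow_le (N := N) hp
  set c : ℝ≥0 := 2 ^ (p - 1) with hc
  have hc' : (2 : ℝ≥0∞) ^ (p - 1) = c := by
    rw [hc, ENNReal.coe_rpow_of_nonneg _ (by linarith)]; rfl
  set m : ℝ≥0 := (2 * (1 + L)) ^ p with hm
  refine ⟨c * (K₁ + m * c * (K₃ + 1)), fun η g hη hg hgi x hx y hy => ?_⟩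
  have hηy : 0 < η y.1 := hy.1.trans hy.2
  set δ := dist x y with hδ
  have hδ0 : 0 ≤ δ := dist_nonneg
  have hv : ‖tentAverage g y‖ₑ ^ p ≤ c * (K₃ * scaledOsc p g y + ‖g y.1‖ₑ ^ p) := by
    calc _ ≤ (‖tentAverage g y - g y.1‖ₑ + ‖g y.1‖ₑ) ^ p := by
          gcongr
          nth_rw 1 [show tentAverage g y = tentAverage g y - g y.1 + g y.1 by ring]
          exact enorm_add_le _ _
      _ ≤ c * (‖tentAverage g y - g y.1‖ₑ ^ p + ‖g y.1‖ₑ ^ p) := by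
          rw [← hc']
          exact ENNReal.rpow_add_le_mul_rpow_add_rpow _ _ hp
      _ ≤ _ := by
          gcongr
          exact h₃ g hg hgi y hy.1
  have hΦ : ‖stripCutoff η x - stripCutoff η y‖ₑ ^ p ≤
      m * ENNReal.ofReal (min 1 (δ / η y.1)) ^ p := by
    rw [hm, ENNReal.coe_rpow_of_nonneg _ hp0, ← ENNReal.mul_rpow_of_nonneg _ _ hp0,
      Real.enorm_eq_ofReal_abs]
    gcongr
    refine (ENNReal.ofReal_le_ofReal (abs_stripCutoff_sub_le hη hx hy)).trans_eq ?_
    rw [ENNReal.ofReal_mul (by positivity)]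
    congr 1
    rw [ENNReal.ofReal, Real.toNNReal_of_nonneg (by positivity)]
    rfl
  -- Product rule, with the increment of the cutoff multiplying the average at y, so that η(y.1) is
  -- the scale paired with values at y.
  have hu : ‖stripExtension η g x - stripExtension η g y‖ₑ ≤
      ‖tentAverage g x - tentAverage g y‖ₑ +
        ‖stripCutoff η x - stripCutoff η y‖ₑ * ‖tentAverage g y‖ₑ := by
    rw [← enorm_mul, show stripExtension η g x - stripExtension η g y =
      stripCutoff η x * (tentAverage g x - tentAverage g y) +
        (stripCutoff η x - stripCutoff η y) * tentAverage g y by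
      unfold stripExtension; ring]
    refine (enorm_add_le _ _).trans ?_
    gcongr
    rw [enorm_mul]
    refine mul_le_of_le_one_left zero_le ?_
    rw [Real.enorm_of_nonneg (stripCutoff_nonneg η x), ENNReal.ofReal_le_one]
    exact stripCutoff_le_one hx
  set D := ENNReal.ofReal (δ ^ (-q)) with hD
  set A := truncKernel p q y.2 δ * scaledOsc p g y
  set B := truncKernel p q x.2 δ * scaledOsc p g x
  set F := farKernel q x.2 y.2 δ * ‖g x.1 - g y.1‖ₑ ^ p
  set H := truncKernel p q (η y.1) δ * ‖g y.1‖ₑ ^ p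
  calc _ ≤ c * (‖tentAverage g x - tentAverage g y‖ₑ ^ p +
        ‖stripCutoff η x - stripCutoff η y‖ₑ ^ p * ‖tentAverage g y‖ₑ ^ p) * D := by
        gcongr
        rw [← hc', ← ENNReal.mul_rpow_of_nonneg _ _ hp0]
        refine (ENNReal.rpow_le_rpow hu hp0).trans ?_
        exact ENNReal.rpow_add_le_mul_rpow_add_rpow _ _ hp
    _ ≤ c * (‖tentAverage g x - tentAverage g y‖ₑ ^ p +
        (m * ENNReal.ofReal (min 1 (δ / η y.1)) ^ p) *
          (c * (K₃ * scaledOsc p g y + ‖g y.1‖ₑ ^ p))) * D := by gcongr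
    _ = c * (‖tentAverage g x - tentAverage g y‖ₑ ^ p * D +
          m * c * (K₃ * (truncKernel p q (η y.1) δ * scaledOsc p g y) + H)) := by
        simp only [H]
        rw [truncKernel_eq_mul hp0 hηy hδ0, ← hD]
        ring
    _ ≤ c * (K₁ * (A + B + F) + m * c * (K₃ * A + H)) := by
        -- The oscillation part of the cutoff term carries the scale η(y.1); as y.2 < η(y.1), it is
        -- dominated by the same term at scale y.2.
        gcongr (c : ℝ≥0∞) * (?_ + m * c * (K₃ * ?_ + H))
        · exact h₁ g hg hgi x y hx.1 hy.1
        · exact mul_le_mul_left (truncKernel_anti hp0 hy.1 hy.2.le hδ0) _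
    _ ≤ c * (K₁ * ((A + H) + (B + F)) + m * c * ((K₃ + 1) * ((A + H) + (B + F)))) := by
        have e₁ : A + B + F ≤ (A + H) + (B + F) := by
          rw [add_assoc]
          exact add_le_add_left le_self_add _
        have e₂ : K₃ * A + H ≤ (K₃ + 1) * ((A + H) + (B + F)) := by
          rw [add_mul, one_mul]
          refine add_le_add (mul_le_mul_right ?_ _) ?_
          · rw [add_assoc]; exact le_self_add
          · rw [add_comm A, add_assoc]; exact le_self_add
        exact mul_le_mul_right (add_le_add (mul_le_mul_right e₁ _) (mul_le_mul_right e₂ _)) _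
    _ = _ := by
        push_cast
        ring

end Pointwise

/-! ### The energy of the extension -/

section Energy

variable {N : ℕ} {s p : ℝ}

theorem measurable_stripExtension {η g : Horiz N → ℝ} (hη : Measurable η) (hg : Measurable g) :
    Measurable (stripExtension η g) := by
  unfold stripExtension stripCutoff
  exact Measurable.mul (by fun_prop) (measurable_tentAverage hg)

theorem dist_le_euclDist (x y : FullSpace N) : dist x y ≤ euclDist x y := by
  refine max_le ?_ ?_
  · rw [dist_eq_norm]
    exact Real.le_sqrt_of_sq_le (by nlinarith [sq_nonneg (x.2 - y.2)])
  · rw [Real.dist_eq]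
    exact Real.le_sqrt_of_sq_le (by rw [sq_abs]; nlinarith [sq_nonneg ‖x.1 - y.1‖])

/-- The sup distance is at most the Euclidean one, so the upper bounds may be proved with the
former. -/
theorem ofReal_div_euclDist_le {q : ℝ} (hp : 0 < p) (hq : 0 ≤ q) (u : FullSpace N → ℝ)
    (x y : FullSpace N) :
    ENNReal.ofReal (|u x - u y| ^ p / euclDist x y ^ q) ≤
      ‖u x - u y‖ₑ ^ p * ENNReal.ofReal (dist x y ^ (-q)) := by
  rcases eq_or_ne x y with rfl | hxy
  · simp [hp.ne']
  have hδ : 0 < dist x y := dist_pos.2 hxy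
  rw [enorm_rpow_eq_ofReal _ hp.le, ← ENNReal.ofReal_mul (by positivity), Real.rpow_neg hδ.le,
    ← div_eq_mul_inv]
  refine ENNReal.ofReal_le_ofReal ?_
  gcongr
  exact dist_le_euclDist x y

/-- The integrand is independent of the height, so the vertical integral supplies one factor η. -/
theorem setLIntegral_weighted_boundary {η g : Horiz N → ℝ} (hp : 0 ≤ p) (hη : Measurable η)
    (hη0 : ∀ x, 0 < η x) (hg : Measurable g) :
    ∫⁻ x in stripDomain η, ENNReal.ofReal (η x.1 ^ (-(s * p))) * ‖g x.1‖ₑ ^ p =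
      ∫⁻ x, ENNReal.ofReal (|g x| ^ p / η x ^ (s * p - 1)) := by
  have hm : Measurable fun x : FullSpace N =>
      ENNReal.ofReal (η x.1 ^ (-(s * p))) * ‖g x.1‖ₑ ^ p := by fun_prop
  rw [setLIntegral_stripDomain hη hm]
  refine lintegral_congr fun x => ?_
  simp only
  rw [setLIntegral_const, Real.volume_Ioo, sub_zero, enorm_rpow_eq_ofReal _ hp,
    ← ENNReal.ofReal_mul (Real.rpow_nonneg (hη0 x).le _),
    ← ENNReal.ofReal_mul (mul_nonneg (Real.rpow_nonneg (hη0 x).le _) (by positivity))]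
  congr 1
  rw [div_eq_mul_inv, ← Real.rpow_neg (hη0 x).le, show -(s * p - 1) = -(s * p) + 1 by ring,
    Real.rpow_add (hη0 x), Real.rpow_one]
  ring

theorem lintegral_add_add_add {α : Type*} [MeasurableSpace α] {μ : Measure α}
    {a b c d : α → ℝ≥0∞} (ha : Measurable a) (hb : Measurable b) (hc : Measurable c) :
    ∫⁻ x, (a x + b x + (c x + d x)) ∂μ =
      (∫⁻ x, a x ∂μ) + (∫⁻ x, b x ∂μ) + ((∫⁻ x, c x ∂μ) + ∫⁻ x, d x ∂μ) := by
  rw [← lintegral_add_left ha, ← lintegral_add_left hc, ← lintegral_add_left (by fun_prop)]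

theorem lintegral_stripExtension_le (hN : 2 ≤ N) (hs1 : s < 1) (hp : 1 < p) (hsp : 1 < s * p)
    (L : ℝ≥0) :
    ∃ K : ℝ≥0, ∀ η g : Horiz N → ℝ, LipschitzWith L η → (∀ x, 0 < η x) → Measurable g →
      LocallyIntegrable g →
      ∫⁻ x in stripDomain η, ∫⁻ y in stripDomain η,
        ENNReal.ofReal (|stripExtension η g x - stripExtension η g y| ^ p /
          euclDist x y ^ ((N : ℝ) + s * p)) ≤
        K * (nearEnergy s p η g + farEnergy s p η g +
          ∫⁻ x, ENNReal.ofReal (|g x| ^ p / η x ^ (s * p - 1))) := by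
  have hp0 : 0 < p := by linarith
  set q : ℝ := N + s * p with hq
  have hq0 : 0 ≤ q := by positivity
  obtain ⟨K₁, h₁⟩ := enorm_stripExtension_sub_rpow_le (N := N) (q := q) hp.le L
  obtain ⟨K₂, h₂⟩ := setLIntegral_truncKernel_mul_le (N := N) (s := s) (p := p) hN (by linarith)
    (by nlinarith)
  obtain ⟨K₃, h₃⟩ := setLIntegral_scaledOsc_le (N := N) (s := s) hN hp0 hsp
  obtain ⟨K₄, h₄⟩ := setLIntegral_farKernel_le (N := N) (s := s) hN hp0 hsp
  refine ⟨K₁ * (2 * K₂ * K₃ + K₂ + K₄), fun η g hη hη0 hg hgi => ?_⟩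
  have hηm : Measurable η := hη.continuous.measurable
  have hΩ := measurableSet_stripDomain hηm
  have hO := measurable_scaledOsc (p := p) hg
  set Ω := stripDomain η
  set V := ∫⁻ x, ENNReal.ofReal (|g x| ^ p / η x ^ (s * p - 1)) with hV
  have hA : Measurable fun w : FullSpace N × FullSpace N =>
      truncKernel p q w.2.2 (dist w.1 w.2) * scaledOsc p g w.2 :=
    (Measurable.truncKernel (by fun_prop) (by fun_prop)).mul (hO.comp measurable_snd)
  have hB : Measurable fun w : FullSpace N × FullSpace N =>
      truncKernel p q w.1.2 (dist w.1 w.2) * scaledOsc p g w.1 :=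
    (Measurable.truncKernel (by fun_prop) (by fun_prop)).mul (hO.comp measurable_fst)
  have hH : Measurable fun w : FullSpace N × FullSpace N =>
      truncKernel p q (η w.2.1) (dist w.1 w.2) * ‖g w.2.1‖ₑ ^ p :=
    (Measurable.truncKernel (by fun_prop) (by fun_prop)).mul (by fun_prop)
  have hF : Measurable fun w : FullSpace N × FullSpace N =>
      farKernel q w.1.2 w.2.2 (dist w.1 w.2) * ‖g w.1.1 - g w.2.1‖ₑ ^ p :=
    (measurable_farKernel q).mul (by fun_prop)
  have iB : ∫⁻ x in Ω, ∫⁻ y in Ω, truncKernel p q x.2 (dist x y) * scaledOsc p g x ≤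
      K₂ * (K₃ * nearEnergy s p η g) :=
    (h₂ Ω (fun x => x.2) (scaledOsc p g) hΩ (fun x hx => hx.1)).trans
      (mul_le_mul_right (h₃ η g hηm hg) _)
  -- Exchanging the two variables turns this term into the previous one.
  have iA : ∫⁻ x in Ω, ∫⁻ y in Ω, truncKernel p q y.2 (dist x y) * scaledOsc p g y ≤
      K₂ * (K₃ * nearEnergy s p η g) := by
    rw [lintegral_lintegral_swap hA.aemeasurable]
    simp_rw [dist_comm]
    exact iB
  have iH : ∫⁻ x in Ω, ∫⁻ y in Ω, truncKernel p q (η y.1) (dist x y) * ‖g y.1‖ₑ ^ p ≤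
      K₂ * V := by
    rw [lintegral_lintegral_swap hH.aemeasurable, hV,
      ← setLIntegral_weighted_boundary hp0.le hηm hη0 hg]
    simp_rw [dist_comm]
    exact h₂ Ω (fun x => η x.1) (fun x => ‖g x.1‖ₑ ^ p) hΩ (fun x _ => hη0 x.1)
  have iF := h₄ η g hηm hη0 hg
  have hA' : ∀ x : FullSpace N, Measurable fun y : FullSpace N =>
      truncKernel p q y.2 (dist x y) * scaledOsc p g y := fun x =>
    (measurable_snd.truncKernel (measurable_const.dist measurable_id)).mul hO
  have hB' : ∀ x : FullSpace N, Measurable fun y : FullSpace N =>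
      truncKernel p q x.2 (dist x y) * scaledOsc p g x := fun x =>
    (measurable_const.truncKernel (measurable_const.dist measurable_id)).mul measurable_const
  have hH' : ∀ x : FullSpace N, Measurable fun y : FullSpace N =>
      truncKernel p q (η y.1) (dist x y) * ‖g y.1‖ₑ ^ p := fun x =>
    ((hηm.comp measurable_fst).truncKernel (measurable_const.dist measurable_id)).mul
      (by fun_prop)
  have jA : Measurable fun x : FullSpace N =>
      ∫⁻ y in Ω, truncKernel p q y.2 (dist x y) * scaledOsc p g y := hA.lintegral_prod_right'
  have jB : Measurable fun x : FullSpace N =>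
      ∫⁻ y in Ω, truncKernel p q x.2 (dist x y) * scaledOsc p g x := hB.lintegral_prod_right'
  have jH : Measurable fun x : FullSpace N =>
      ∫⁻ y in Ω, truncKernel p q (η y.1) (dist x y) * ‖g y.1‖ₑ ^ p := hH.lintegral_prod_right'
  calc _ ≤ ∫⁻ x in Ω, ∫⁻ y in Ω,
        K₁ * ((truncKernel p q y.2 (dist x y) * scaledOsc p g y +
            truncKernel p q (η y.1) (dist x y) * ‖g y.1‖ₑ ^ p) +
            (truncKernel p q x.2 (dist x y) * scaledOsc p g x +
            farKernel q x.2 y.2 (dist x y) * ‖g x.1 - g y.1‖ₑ ^ p)) := by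
        refine setLIntegral_mono' hΩ fun x hx => setLIntegral_mono' hΩ fun y hy => ?_
        exact (ofReal_div_euclDist_le hp0 hq0 _ x y).trans (h₁ η g hη hg hgi x hx y hy)
    _ = K₁ * (((∫⁻ x in Ω, ∫⁻ y in Ω, truncKernel p q y.2 (dist x y) * scaledOsc p g y) +
          ∫⁻ x in Ω, ∫⁻ y in Ω, truncKernel p q (η y.1) (dist x y) * ‖g y.1‖ₑ ^ p) +
          ((∫⁻ x in Ω, ∫⁻ y in Ω, truncKernel p q x.2 (dist x y) * scaledOsc p g x) +
          ∫⁻ x in Ω, ∫⁻ y in Ω,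
            farKernel q x.2 y.2 (dist x y) * ‖g x.1 - g y.1‖ₑ ^ p)) := by
        simp_rw [lintegral_const_mul' _ _ (ENNReal.coe_ne_top (r := K₁))]
        simp_rw [fun x => lintegral_add_add_add (μ := volume.restrict Ω)
          (d := fun y => farKernel q x.2 y.2 (dist x y) * ‖g x.1 - g y.1‖ₑ ^ p)
          (hA' x) (hH' x) (hB' x)]
        rw [lintegral_add_add_add jA jH jB]
    _ ≤ K₁ * ((K₂ * (K₃ * nearEnergy s p η g) + K₂ * V) +
          (K₂ * (K₃ * nearEnergy s p η g) +
            K₄ * (nearEnergy s p η g + farEnergy s p η g))) := by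
        gcongr
    _ ≤ K₁ * ((K₂ * (K₃ * (nearEnergy s p η g + farEnergy s p η g + V)) +
          K₂ * (nearEnergy s p η g + farEnergy s p η g + V)) +
          (K₂ * (K₃ * (nearEnergy s p η g + farEnergy s p η g + V)) +
            K₄ * (nearEnergy s p η g + farEnergy s p η g + V))) := by
        have a1 : nearEnergy s p η g ≤ nearEnergy s p η g + farEnergy s p η g + V := by
          rw [add_assoc]; exact le_self_add
        have a2 : V ≤ nearEnergy s p η g + farEnergy s p η g + V := le_add_self
        have a3 : nearEnergy s p η g + farEnergy s p η g ≤
          nearEnergy s p η g + farEnergy s p η g + V := le_self_add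
        refine mul_le_mul_right (add_le_add (add_le_add ?_ ?_) (add_le_add ?_ ?_)) _
        · exact mul_le_mul_right (mul_le_mul_right a1 _) _
        · exact mul_le_mul_right a2 _
        · exact mul_le_mul_right (mul_le_mul_right a1 _) _
        · exact mul_le_mul_right a3 _
    _ = _ := by
        push_cast
        ring

end Energy

/-! ### Boundary traces -/

section Trace

variable {N : ℕ}

theorem euclBall_subset_prod (x : FullSpace N) (r : ℝ) :
    euclBall x r ⊆ Metric.ball x.1 r ×ˢ Metric.ball x.2 r := by
  intro y hy
  have h : dist y x < r := (dist_le_euclDist y x).trans_lt hy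
  exact ⟨(le_max_left _ _).trans_lt h, (le_max_right _ _).trans_lt h⟩

theorem prod_subset_stripDomain_inter {L : ℝ≥0} {η : Horiz N → ℝ} (hη : LipschitzWith L η)
    {x : Horiz N} {r : ℝ} (hr : 0 < r) (hrx : (2 + 2 * L) * r < η x) :
    Metric.ball x (r / 2) ×ˢ Ioo 0 (r / 2) ⊆ stripDomain η ∩ euclBall (x, 0) r := by
  rintro y ⟨hy1, hy2⟩
  have hL : (0 : ℝ) ≤ L := L.2
  have h1 : dist (η x) (η y.1) ≤ L * dist x y.1 := hη.dist_le_mul _ _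
  rw [Metric.mem_ball] at hy1
  refine ⟨⟨hy2.1, ?_⟩, ?_⟩
  · rw [dist_comm x, Real.dist_eq] at h1
    have := le_abs_self (η x - η y.1)
    have h2 : L * dist y.1 x ≤ L * r := by gcongr; linarith
    nlinarith [hy2.2]
  · change Real.sqrt _ < r
    rw [dist_eq_norm] at hy1
    rw [Real.sqrt_lt' hr]
    have := norm_nonneg (y.1 - x)
    have a : ‖y.1 - x‖ ^ 2 < (r / 2) ^ 2 := by gcongr
    have b : (y.2 - 0) ^ 2 < (r / 2) ^ 2 := by
      rw [sub_zero]
      have := hy2.1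
      have := hy2.2
      gcongr
    have : (r / 2) ^ 2 + (r / 2) ^ 2 ≤ r ^ 2 := by nlinarith
    change ‖y.1 - x‖ ^ 2 + (y.2 - 0) ^ 2 < r ^ 2
    linarith

theorem half_le_of_mem_ball {L : ℝ≥0} {η : Horiz N → ℝ} (hη : LipschitzWith L η)
    {x y : Horiz N} {r : ℝ} (hr : 0 < r) (hrx : (2 + 2 * L) * r < η x)
    (hy : y ∈ Metric.ball x r) : η x / 2 ≤ η y := by
  have h1 : dist (η x) (η y) ≤ L * dist x y := hη.dist_le_mul _ _
  rw [Metric.mem_ball, dist_comm] at hy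
  have hL : (0 : ℝ) ≤ L := L.2
  have h2 : L * dist x y ≤ L * r := by gcongr
  rw [Real.dist_eq] at h1
  have := le_abs_self (η x - η y)
  nlinarith

theorem eventually_mul_lt {c a : ℝ} (ha : 0 < a) : ∀ᶠ r : ℝ in 𝓝[>] 0, c * r < a := by
  refine nhdsWithin_le_nhds ?_
  have : Tendsto (fun r : ℝ => c * r) (𝓝 0) (𝓝 (c * 0)) := by
    exact (continuous_const.mul continuous_id).tendsto 0
  rw [mul_zero] at this
  exact this.eventually (gt_mem_nhds ha)

theorem hasTraceOnGraph_top {L : ℝ≥0} {η g : Horiz N → ℝ} (hη : LipschitzWith L η)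
    (hη0 : ∀ x, 0 < η x) :
    HasTraceOnGraph (stripDomain η) (stripExtension η g) η (fun _ => 0) := by
  refine ae_of_all _ fun x => tendsto_const_nhds.congr' ?_
  filter_upwards [eventually_mul_lt (c := 2 + 2 * L) (hη0 x), self_mem_nhdsWithin] with r hr hr0
  have hr0 : 0 < r := hr0
  have hΩ : MeasurableSet (stripDomain η ∩ euclBall (x, η x) r) := by
    refine (measurableSet_stripDomain hη.continuous.measurable).inter ?_
    unfold euclBall euclDist
    exact measurableSet_lt (by fun_prop) measurable_const
  symm
  rw [setLAverage_eq]
  convert ENNReal.zero_div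
  rw [setLIntegral_congr_fun hΩ (g := fun _ => 0), lintegral_zero]
  rintro y ⟨hyΩ, hy⟩
  have hy' := euclBall_subset_prod _ _ hy
  have h2 : dist y.2 (η x) < r := hy'.2
  have h1 : dist (η y.1) (η x) ≤ L * dist y.1 x := hη.dist_le_mul _ _
  have h3 : dist y.1 x < r := hy'.1
  have hL : (0 : ℝ) ≤ L := L.2
  have h4 : L * dist y.1 x ≤ L * r := by gcongr
  rw [Real.dist_eq, abs_lt] at h2
  rw [Real.dist_eq] at h1
  have h5 := le_abs_self (η y.1 - η x)
  -- Near the upper graph y.2 > η(x) - r and η(y.1) ≤ η(x) + Lr, so (2 + 2L) r < η(x) puts y in the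
  -- upper half of the strip.
  have hcut : stripCutoff η y = 0 := by
    refine max_eq_left ?_
    have : 1 / 2 ≤ y.2 / η y.1 := by
      rw [le_div_iff₀ (hη0 _)]
      nlinarith
    linarith
  simp [stripExtension, hcut]

theorem abs_stripExtension_sub_le {η g : Horiz N → ℝ} {y : FullSpace N}
    (hy : y ∈ stripDomain η) (a : ℝ) :
    |stripExtension η g y - a| ≤ |tentAverage g y - a| + 2 * (y.2 / η y.1) * |a| := by
  have h0 := stripCutoff_nonneg η y
  have h1 := stripCutoff_le_one hy
  have h2 : 1 - 2 * (y.2 / η y.1) ≤ stripCutoff η y := le_max_right _ _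
  rw [show stripExtension η g y - a = stripCutoff η y * (tentAverage g y - a) -
    (1 - stripCutoff η y) * a by unfold stripExtension; ring]
  refine (abs_sub _ _).trans ?_
  rw [abs_mul, abs_mul, abs_of_nonneg h0, abs_of_nonneg (sub_nonneg.2 h1)]
  gcongr
  · exact mul_le_of_le_one_left (abs_nonneg _) h1
  · linarith

/-- By Fubini, at each height t a point z is counted on a ball of radius t/4, whose measure cancels
the normalisation up to κ; the height then contributes r. -/
theorem setLIntegral_scaledLIntegral_le : ∃ K : ℝ≥0, ∀ f : Horiz N → ℝ≥0∞, Measurable f →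
    ∀ (x : Horiz N) (r : ℝ), 0 < r →
      ∫⁻ y in Metric.ball x r ×ˢ Ioo 0 r, scaledLIntegral f y (1 / 4) ≤
        K * ENNReal.ofReal r * ∫⁻ z in Metric.closedBall x (2 * r), f z := by
  have hκ : ENNReal.ofReal ((1 / 4) ^ Module.finrank ℝ (Horiz N)) *
      volume (Metric.ball (0 : Horiz N) 1) ≠ ∞ :=
    ENNReal.mul_ne_top ENNReal.ofReal_ne_top measure_ball_lt_top.ne
  set κ := ENNReal.ofReal ((1 / 4) ^ Module.finrank ℝ (Horiz N)) *
      volume (Metric.ball (0 : Horiz N) 1) with hκd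
  refine ⟨κ.toNNReal, fun f hf x r hr => ?_⟩
  have hS : Measurable fun y : FullSpace N => scaledLIntegral f y (1 / 4) :=
    measurable_uncurry_scaledLIntegral (f := fun _ => f) (hf.comp measurable_snd) _
  rw [ENNReal.coe_toNNReal hκ, Measure.volume_eq_prod, ← Measure.prod_restrict,
    lintegral_prod_symm _ hS.aemeasurable]
  have key : ∀ t ∈ Ioo 0 r, ∫⁻ y in Metric.ball x r, scaledLIntegral f (y, t) (1 / 4) ≤
      κ * ∫⁻ z in Metric.closedBall x (2 * r), f z := by
    intro t ht
    set F : Horiz N → Horiz N → ℝ≥0∞ := fun y z =>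
      {w : Horiz N × Horiz N | dist w.2 w.1 < 1 / 4 * t}.indicator (fun w => f w.2) (y, z) with hF
    have hFm : Measurable (Function.uncurry F) :=
      Measurable.indicator (by fun_prop) (measurableSet_lt (by fun_prop) (by fun_prop))
    have h1 : ∀ y ∈ Metric.ball x r, ∫⁻ z in Metric.ball y (1 / 4 * t), f z ≤
        ∫⁻ z in Metric.closedBall x (2 * r), F y z := by
      intro y hy
      rw [← lintegral_indicator Metric.isOpen_ball.measurableSet,
        ← lintegral_indicator Metric.isClosed_closedBall.measurableSet]
      refine lintegral_mono fun z => ?_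
      refine indicator_le (fun z hz => ?_) z
      rw [Metric.mem_ball] at hz hy
      have hz' : z ∈ Metric.closedBall x (2 * r) := by
        rw [Metric.mem_closedBall]
        linarith [dist_triangle z y x, ht.2]
      rw [indicator_of_mem hz', hF]
      simp only
      rw [indicator_of_mem (by exact hz)]
    unfold scaledLIntegral
    simp only
    rw [lintegral_const_mul' _ _ ENNReal.ofReal_ne_top]
    calc _ ≤ ENNReal.ofReal ((t ^ Module.finrank ℝ (Horiz N))⁻¹) *
          ∫⁻ y in Metric.ball x r, ∫⁻ z in Metric.closedBall x (2 * r), F y z := by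
          gcongr 1
          exact setLIntegral_mono' Metric.isOpen_ball.measurableSet h1
      _ ≤ ENNReal.ofReal ((t ^ Module.finrank ℝ (Horiz N))⁻¹) *
          ∫⁻ z in Metric.closedBall x (2 * r), ∫⁻ y, F y z := by
          rw [lintegral_lintegral_swap hFm.aemeasurable]
          gcongr
          exact Measure.restrict_le_self
      _ = ∫⁻ z in Metric.closedBall x (2 * r), κ * f z := by
          rw [← lintegral_const_mul' _ _ ENNReal.ofReal_ne_top]
          refine lintegral_congr fun z => ?_
          have : ∀ y, F y z = (Metric.ball z (1 / 4 * t)).indicator (fun _ => f z) y := by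
            intro y
            simp [hF, indicator, dist_comm z y]
          simp_rw [this]
          rw [lintegral_indicator Metric.isOpen_ball.measurableSet, setLIntegral_const, hκd,
            ← volume_ball_mul_inv (y := (z, t)) ht.1 (by norm_num)]
          ring
      _ = _ := lintegral_const_mul' _ _ hκ
  refine (setLIntegral_mono' measurableSet_Ioo key).trans ?_
  rw [setLIntegral_const, Real.volume_Ioo, sub_zero]
  exact le_of_eq (by ring)

theorem hasTraceOnGraph_bottom {L : ℝ≥0} {η g : Horiz N → ℝ} (hη : LipschitzWith L η)
    (hη0 : ∀ x, 0 < η x) (hg : Measurable g) (hgi : LocallyIntegrable g) :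
    HasTraceOnGraph (stripDomain η) (stripExtension η g) (fun _ => 0) g := by
  obtain ⟨K₁, h₁⟩ := enorm_tentAverage_sub_le (E := Horiz N)
  obtain ⟨K₂, h₂⟩ := setLIntegral_scaledLIntegral_le (N := N)
  -- x is taken to be a Lebesgue point of g. The differentiation basis consists of closed balls, and
  -- radius 2r covers all the averaging balls involved.
  filter_upwards [(Besicovitch.vitaliFamily volume).ae_tendsto_lintegral_enorm_sub_div hgi]
    with x hx
  have hδ : Tendsto (fun r : ℝ => 2 * r) (𝓝[>] 0) (𝓝[>] 0) := by
    refine tendsto_nhdsWithin_iff.2 ⟨?_, ?_⟩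
    · have : Tendsto (fun r : ℝ => 2 * r) (𝓝 0) (𝓝 (2 * 0)) :=
        (continuous_const.mul continuous_id).tendsto 0
      rw [mul_zero] at this
      exact this.mono_left nhdsWithin_le_nhds
    · filter_upwards [self_mem_nhdsWithin] with r hr
      exact mul_pos (two_pos (α := ℝ)) (mem_Ioi.1 hr)
  have hx' := hx.comp ((Besicovitch.tendsto_filterAt volume x).comp hδ)
  set d := Module.finrank ℝ (Horiz N) with hd
  set f : Horiz N → ℝ≥0∞ := fun z => ‖g z - g x‖ₑ with hf
  -- The factor 4^d compares the balls of radii 2r and r/2, and the factor 2 compares r with the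
  -- height r/2 of the cylinder inside the domain.
  set c : ℝ≥0∞ := K₁ * K₂ * (ENNReal.ofReal (4 ^ d) * 2) with hc
  have hc' : c ≠ ∞ := by
    rw [hc]
    exact ENNReal.mul_ne_top (ENNReal.mul_ne_top ENNReal.coe_ne_top ENNReal.coe_ne_top)
      (ENNReal.mul_ne_top ENNReal.ofReal_ne_top ENNReal.ofNat_ne_top)
  have lim : Tendsto (fun r : ℝ => c * ((∫⁻ z in Metric.closedBall x (2 * r), f z) /
      volume (Metric.closedBall x (2 * r))) + ENNReal.ofReal (4 / η x * |g x| * r))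
      (𝓝[>] 0) (𝓝 0) := by
    have l1 := ENNReal.Tendsto.const_mul (a := c) hx' (Or.inr hc')
    have l2 : Tendsto (fun r : ℝ => ENNReal.ofReal (4 / η x * |g x| * r)) (𝓝[>] 0) (𝓝 0) := by
      have : Tendsto (fun r : ℝ => ENNReal.ofReal (4 / η x * |g x| * r)) (𝓝 0)
          (𝓝 (ENNReal.ofReal (4 / η x * |g x| * 0))) :=
        (ENNReal.continuous_ofReal.comp (continuous_const.mul continuous_id)).tendsto 0
      rw [mul_zero, ENNReal.ofReal_zero] at this
      exact this.mono_left nhdsWithin_le_nhds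
    rw [mul_zero] at l1
    have := l1.add l2
    rw [add_zero] at this
    exact this
  refine tendsto_of_tendsto_of_tendsto_of_le_of_le' tendsto_const_nhds lim
    (Eventually.of_forall fun _ => zero_le) ?_
  filter_upwards [eventually_mul_lt (c := 2 + 2 * L) (hη0 x), self_mem_nhdsWithin] with r hr hr0
  have hr0 : 0 < r := hr0
  set U := stripDomain η ∩ euclBall (x, 0) r with hU
  have hUm : MeasurableSet U := by
    refine (measurableSet_stripDomain hη.continuous.measurable).inter ?_
    unfold euclBall euclDist
    exact measurableSet_lt (by fun_prop) measurable_const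
  have hUsub : U ⊆ Metric.ball x r ×ˢ Ioo 0 r := by
    rintro y ⟨hyΩ, hy⟩
    have hy' := euclBall_subset_prod _ _ hy
    refine ⟨hy'.1, hyΩ.1, ?_⟩
    have h2 : dist y.2 0 < r := hy'.2
    rw [Real.dist_eq, sub_zero] at h2
    exact (le_abs_self _).trans_lt h2
  have hvol : volume (Metric.ball x (r / 2)) * ENNReal.ofReal (r / 2) ≤ volume U := by
    refine le_trans (le_of_eq ?_) (measure_mono (prod_subset_stripDomain_inter hη hr0 hr))
    rw [Measure.volume_eq_prod, Measure.prod_prod, Real.volume_Ioo, sub_zero]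
  have hball : volume (Metric.closedBall x (2 * r)) =
      ENNReal.ofReal (4 ^ d) * volume (Metric.ball x (r / 2)) := by
    rw [Measure.addHaar_closedBall _ _ (by positivity),
      Measure.addHaar_ball_of_pos _ _ (by positivity : 0 < r / 2), ← mul_assoc,
      ← ENNReal.ofReal_mul (by positivity), ← mul_pow]
    congr 3
    ring
  -- The last term is the error of the cutoff, which is 1 - O(r/η(x)) at heights below r.
  have hpt : ∀ y ∈ U, ENNReal.ofReal |stripExtension η g y - g x| ≤
      K₁ * scaledLIntegral f y (1 / 4) + ENNReal.ofReal (4 / η x * |g x| * r) := by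
    intro y hy
    have hyU := hUsub hy
    have hηy := half_le_of_mem_ball hη hr0 hr hyU.1
    refine (ENNReal.ofReal_le_ofReal (abs_stripExtension_sub_le hy.1 (g x))).trans ?_
    refine ENNReal.ofReal_add_le.trans ?_
    rw [← Real.enorm_eq_ofReal_abs]
    refine add_le_add (h₁ g hgi y hy.1.1 _) (ENNReal.ofReal_le_ofReal ?_)
    have hxx := hη0 x
    have : y.2 / η y.1 ≤ r / (η x / 2) := by
      have := hyU.2.2.le
      gcongr
    calc _ ≤ 2 * (r / (η x / 2)) * |g x| := by gcongr
      _ = _ := by field_simp; ring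
  have hUfin : volume U ≠ ∞ := by
    refine ((measure_mono hUsub).trans_lt ?_).ne
    rw [Measure.volume_eq_prod, Measure.prod_prod]
    exact ENNReal.mul_lt_top measure_ball_lt_top (by simp)
  have hB0 : volume (Metric.ball x (r / 2)) ≠ 0 :=
    (Metric.measure_ball_pos volume x (by positivity)).ne'
  have hr2 : ENNReal.ofReal (r / 2) ≠ 0 := by
    rw [ne_eq, ENNReal.ofReal_eq_zero, not_le]; positivity
  have hU0 : volume U ≠ 0 := fun h => by
    rw [h] at hvol
    exact mul_ne_zero hB0 hr2 (le_antisymm hvol zero_le)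
  have hint : ∫⁻ y in U, ENNReal.ofReal |stripExtension η g y - g x| ≤
      K₁ * (K₂ * ENNReal.ofReal r * ∫⁻ z in Metric.closedBall x (2 * r), f z) +
        ENNReal.ofReal (4 / η x * |g x| * r) * volume U := by
    refine (setLIntegral_mono' hUm hpt).trans ?_
    rw [lintegral_add_right _ measurable_const, setLIntegral_const,
      lintegral_const_mul' _ _ ENNReal.coe_ne_top]
    gcongr
    exact (lintegral_mono_set hUsub).trans (h₂ f (by fun_prop) x r hr0)
  rw [setLAverage_eq]
  refine (ENNReal.div_le_div_right hint _).trans ?_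
  rw [ENNReal.add_div, ENNReal.mul_div_cancel_right hU0 hUfin]
  gcongr
  refine (ENNReal.div_le_div_left hvol _).trans (le_of_eq ?_)
  have h4 : ENNReal.ofReal (4 ^ d) ≠ 0 := by
    rw [ne_eq, ENNReal.ofReal_eq_zero, not_le]; positivity
  have hrr : ENNReal.ofReal r = 2 * ENNReal.ofReal (r / 2) := by
    rw [show (2 : ℝ≥0∞) = ENNReal.ofReal 2 by simp, ← ENNReal.ofReal_mul (by norm_num)]
    congr 1; ring
  rw [hball, hrr, hc]
  have hBf : volume (Metric.ball x (r / 2)) ≠ ∞ := measure_ball_lt_top.ne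
  rw [ENNReal.div_eq_inv_mul, ENNReal.div_eq_inv_mul, ENNReal.mul_inv (Or.inl hB0) (Or.inl hBf),
    ENNReal.mul_inv (Or.inl h4) (Or.inl ENNReal.ofReal_ne_top)]
  have c1 : (ENNReal.ofReal (r / 2))⁻¹ * ENNReal.ofReal (r / 2) = 1 :=
    ENNReal.inv_mul_cancel hr2 ENNReal.ofReal_ne_top
  have c2 : ENNReal.ofReal (4 ^ d) * (ENNReal.ofReal (4 ^ d))⁻¹ = 1 :=
    ENNReal.mul_inv_cancel h4 ENNReal.ofReal_ne_top
  set I := ∫⁻ z in Metric.closedBall x (2 * r), f z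
  set B := (volume (Metric.ball x (r / 2)))⁻¹
  calc _ = ((ENNReal.ofReal (r / 2))⁻¹ * ENNReal.ofReal (r / 2)) * (2 * K₁ * K₂ * B * I) := by
        ring
    _ = (ENNReal.ofReal (4 ^ d) * (ENNReal.ofReal (4 ^ d))⁻¹) * (2 * K₁ * K₂ * B * I) := by
        rw [c1, c2]
    _ = _ := by ring

end Trace

/-! ### Local integrability and conclusion -/

section Main

variable {N : ℕ} {s p : ℝ}

theorem MemLpLoc.locallyIntegrable {g : Horiz N → ℝ} (hp : 1 ≤ p)
    (hg : MemLpLoc g p Set.univ) : LocallyIntegrable g := by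
  refine locallyIntegrable_iff.2 fun K hK => ?_
  have : IsFiniteMeasure (volume.restrict K) := ⟨by simpa using hK.measure_lt_top⟩
  exact (hg K hK (subset_univ K)).integrable (by simpa using hp)

theorem nearEnergy_congr {η g g' : Horiz N → ℝ} (h : g =ᵐ[volume] g') :
    nearEnergy s p η g = nearEnergy s p η g' := by
  refine lintegral_congr_ae ?_
  filter_upwards [h] with x hx
  refine lintegral_congr_ae ?_
  filter_upwards [ae_restrict_of_ae h] with y hy
  rw [hx, hy]

theorem farEnergy_congr {η g g' : Horiz N → ℝ} (h : g =ᵐ[volume] g') :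
    farEnergy s p η g = farEnergy s p η g' := by
  refine lintegral_congr_ae ?_
  filter_upwards [h] with x hx
  refine lintegral_congr_ae ?_
  filter_upwards [ae_restrict_of_ae h] with y hy
  rw [hx, hy]

theorem eLpNorm_div_rpow_eq {η g : Horiz N → ℝ} (hp : 0 < p) (hη0 : ∀ x, 0 < η x) :
    eLpNorm (fun x => g x / η x ^ (s - 1 / p)) (ENNReal.ofReal p) volume =
      (∫⁻ x, ENNReal.ofReal (|g x| ^ p / η x ^ (s * p - 1))) ^ (1 / p) := by
  rw [eLpNorm_eq_lintegral_rpow_enorm_toReal (by simpa using hp) ENNReal.ofReal_ne_top,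
    ENNReal.toReal_ofReal hp.le]
  congr 1
  refine lintegral_congr fun x => ?_
  have hx := hη0 x
  rw [enorm_rpow_eq_ofReal _ hp.le, abs_div, abs_of_pos (Real.rpow_pos_of_pos hx _),
    Real.div_rpow (abs_nonneg _) (by positivity), ← Real.rpow_mul hx.le]
  congr 4
  field_simp

/-- On a compact subset the heights stay away from 0, so the tent averages are bounded by one
integral of |g| over a large ball. -/
theorem memLpLoc_stripExtension {η g : Horiz N → ℝ} (hη : Measurable η) (hg : Measurable g)
    (hgi : LocallyIntegrable g) : MemLpLoc (stripExtension η g) p (stripDomain η) := by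
  intro K hK hKΩ
  have : IsFiniteMeasure (volume.restrict K) := ⟨by simpa using hK.measure_lt_top⟩
  obtain ⟨K₁, h₁⟩ := enorm_tentAverage_sub_le (E := Horiz N)
  obtain ⟨t, ht, htK⟩ := hK.exists_forall_le' (f := fun x : FullSpace N => x.2) (a := 0)
    continuous_snd.continuousOn fun x hx => (hKΩ hx).1
  obtain ⟨R, hR⟩ := hK.isBounded.subset_closedBall 0
  set d := Module.finrank ℝ (Horiz N)
  set B : ℝ≥0∞ := K₁ * (ENNReal.ofReal ((t ^ d)⁻¹) *
    ∫⁻ z in Metric.closedBall (0 : Horiz N) (2 * R), ‖g z‖ₑ) with hB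
  have hBfin : B ≠ ∞ := by
    refine ENNReal.mul_ne_top ENNReal.coe_ne_top (ENNReal.mul_ne_top ENNReal.ofReal_ne_top ?_)
    exact (hgi.integrableOn_isCompact (isCompact_closedBall _ _)).2.ne
  refine MemLp.of_bound (measurable_stripExtension hη hg).aestronglyMeasurable B.toReal ?_
  filter_upwards [ae_restrict_mem hK.measurableSet] with x hx
  have hxΩ := hKΩ hx
  have hxR : dist x 0 ≤ R := hR hx
  have hx1 : dist x.1 0 ≤ R := (le_max_left _ _).trans hxR
  have hx2 : dist x.2 0 ≤ R := (le_max_right _ _).trans hxR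
  rw [Real.dist_eq, sub_zero] at hx2
  have hx2' := (le_abs_self _).trans hx2
  have htx : t ≤ x.2 := htK x hx
  rw [← toReal_enorm]
  refine ENNReal.toReal_mono hBfin ?_
  rw [stripExtension, enorm_mul]
  refine (mul_le_of_le_one_left zero_le ?_).trans ?_
  · rw [Real.enorm_of_nonneg (stripCutoff_nonneg η x), ENNReal.ofReal_le_one]
    exact stripCutoff_le_one hxΩ
  · have h := h₁ g hgi x hxΩ.1 0
    simp only [sub_zero] at h
    refine h.trans ?_
    rw [hB, scaledLIntegral]
    gcongr
    intro z hz
    rw [Metric.mem_ball] at hz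
    rw [Metric.mem_closedBall]
    linarith [dist_triangle z x.1 0]

end Main

theorem mainTheorem2 (N : ℕ) (hN : 2 ≤ N) (s p : ℝ) (hs0 : 0 < s) (hs1 : s < 1)
    (hp : 1 < p) (hsp : 1 < s * p) (L : ℝ≥0) :
    ∃ C : ℝ, 0 < C ∧
      ∀ η : Horiz N → ℝ, LipschitzWith L η → (∀ x, 0 < η x) →
      ∀ g : Horiz N → ℝ, MemLpLoc g p Set.univ →
        nearEnergy s p η g < ∞ →
        farEnergy s p η g < ∞ →
        (∫⁻ x, ENNReal.ofReal (|g x| ^ p / η x ^ (s * p - 1))) < ∞ →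
        ∃ u : FullSpace N → ℝ,
          MemHomSobolev s p (stripDomain η) u ∧
          HasTraceOnGraph (stripDomain η) u (fun _ => 0) g ∧
          HasTraceOnGraph (stripDomain η) u η (fun _ => 0) ∧
          ENNReal.ofReal C * gagliardo s p (stripDomain η) u ≤
            nearEnergy s p η g ^ (1 / p) + farEnergy s p η g ^ (1 / p) +
              eLpNorm (fun x => g x / η x ^ (s - 1 / p)) (ENNReal.ofReal p) volume := by
  have hp0 : 0 < p := by linarith
  have hp1 : 0 ≤ 1 / p := by positivity
  have hp2 : 1 / p ≤ 1 := by rw [div_le_one hp0]; exact hp.le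
  obtain ⟨K, hK⟩ := lintegral_stripExtension_le (s := s) hN hs1 hp hsp L
  -- Adding 1 makes `M` positive, hence invertible.
  set M : ℝ≥0 := (K + 1) ^ (1 / p) with hM
  have hM0 : 0 < M := NNReal.rpow_pos (by positivity)
  refine ⟨(M⁻¹ : ℝ≥0), by exact_mod_cast inv_pos.2 hM0, fun η hη hη0 g hg hnear hfar hV => ?_⟩
  have hgi₀ := hg.locallyIntegrable hp.le
  -- A Borel representative of g; the energies, the weighted norm and the trace condition do not
  -- change under null modifications.
  obtain ⟨g', hg'm, hgg'⟩ : ∃ g' : Horiz N → ℝ, Measurable g' ∧ g =ᵐ[volume] g' :=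
    ⟨hgi₀.aestronglyMeasurable.mk g, hgi₀.aestronglyMeasurable.stronglyMeasurable_mk.measurable,
      hgi₀.aestronglyMeasurable.ae_eq_mk⟩
  have hgi : LocallyIntegrable g' := locallyIntegrable_iff.2 fun k hk =>
    (locallyIntegrable_iff.1 hgi₀ k hk).congr_fun_ae (ae_restrict_of_ae hgg')
  have hVeq : ∫⁻ x, ENNReal.ofReal (|g x| ^ p / η x ^ (s * p - 1)) =
      ∫⁻ x, ENNReal.ofReal (|g' x| ^ p / η x ^ (s * p - 1)) := by
    refine lintegral_congr_ae ?_
    filter_upwards [hgg'] with x hx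
    rw [hx]
  have hI := hK η g' hη hη0 hg'm hgi
  rw [← nearEnergy_congr hgg', ← farEnergy_congr hgg', ← hVeq] at hI
  rw [eLpNorm_div_rpow_eq hp0 hη0]
  set V := ∫⁻ x, ENNReal.ofReal (|g x| ^ p / η x ^ (s * p - 1))
  set A := nearEnergy s p η g
  set B := farEnergy s p η g
  have hgag : gagliardo s p (stripDomain η) (stripExtension η g') ≤
      M * (A + B + V) ^ (1 / p) := by
    rw [gagliardo, hM, ENNReal.coe_rpow_of_nonneg _ hp1, ← ENNReal.mul_rpow_of_nonneg _ _ hp1]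
    refine ENNReal.rpow_le_rpow (hI.trans ?_) hp1
    gcongr
    exact_mod_cast le_self_add
  refine ⟨stripExtension η g', ⟨memLpLoc_stripExtension hη.continuous.measurable hg'm hgi, ?_⟩,
    ?_, hasTraceOnGraph_top hη hη0, ?_⟩
  · refine hgag.trans_lt (ENNReal.mul_lt_top ENNReal.coe_lt_top ?_)
    exact ENNReal.rpow_lt_top_of_nonneg hp1
      (ENNReal.add_lt_top.2 ⟨ENNReal.add_lt_top.2 ⟨hnear, hfar⟩, hV⟩).ne
  · filter_upwards [hasTraceOnGraph_bottom hη hη0 hg'm hgi, hgg'] with x hx hgx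
    rw [hgx]
    exact hx
  · rw [ENNReal.ofReal_coe_nnreal]
    calc _ ≤ (M⁻¹ : ℝ≥0) * (M * (A + B + V) ^ (1 / p)) := by gcongr
      _ = (A + B + V) ^ (1 / p) := by
          rw [← mul_assoc, ← ENNReal.coe_mul, inv_mul_cancel₀ hM0.ne', ENNReal.coe_one, one_mul]
      -- As 1/p ≤ 1, the power is subadditive.
      _ ≤ (A + B) ^ (1 / p) + V ^ (1 / p) := ENNReal.rpow_add_le_add_rpow _ _ hp1 hp2
      _ ≤ _ := by
          gcongr
          exact ENNReal.rpow_add_le_add_rpow _ _ hp1 hp2
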